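/- Let $\mathbb T$ be the unit circle, $m_n$ and $m$ the products of the normalized Lebesgue measure on $\mathbb T^n$ and $\mathbb T^\infty=\mathbb T^{\mathbb N}$, and let $\mathbb Z^{(\mathbb N)}$, $\mathbb N_0^{(\mathbb N)}$ be the sets of finitely supported sequences in $\mathbb Z$ and in $\mathbb N_0$. For $1\le p<\infty$ let $H_p(\mathbb T^\infty)$ be the subspace of those $f\in L_p(\mathbb T^\infty)$ whose Fourier coefficients $\hat f(\alpha)=\int_{\mathbb T^\infty} f(w)\,w^{-\alpha}\,dm(w)$ vanish for all $\alpha\in\mathbb Z^{(\mathbb N)}\setminus\mathbb N_0^{(\mathbb N)}$, with the norm of $L_p(\mathbb T^\infty)$. Let $\mathbb D^\infty\cap\ell_2=\{z\in\ell_2: \sup_i|z_i|<1\}$, an open subset of the complex Hilbert space $\ell_2$, and let $H_p(\mathbb D^\infty)$ be the space of all holomorphic (that is, complex Fréchet differentiable) functions $g:\mathbb D^\infty\cap\ell_2\to\mathbb C$ with $$\|g\|_{H_p(\mathbb D^\infty)}=\sup_{n\in\mathbb N}\ \sup_{0<r<1}\Big(\int_{\mathbb T^n}|g(rw_1,\dots,rw_n,0,0,\dots)|^p\,dm_n(w_1,\dots,w_n)\Big)^{1/p}<\infty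 .$$ **Theorem 5.1.** Let $1\le p<\infty$. For every $f\in H_p(\mathbb T^\infty)$ and $z\in\mathbb D^\infty\cap\ell_2$ the series $$\phi(f)(z)=\sum_{\alpha\in\mathbb N_0^{(\mathbb N)}}\hat f(\alpha)\,z^\alpha$$ converges absolutely, $\phi(f)$ belongs to $H_p(\mathbb D^\infty)$, and $\phi:H_p(\mathbb T^\infty)\to H_p(\mathbb D^\infty)$ is a linear isometry. If $1<p<\infty$, then $\phi$ is onto. If $p=1$, then $\phi(H_1(\mathbb T^\infty))$ is the closure in $H_1(\mathbb D^\infty)$, for the norm $\|\cdot\|_{H_1(\mathbb D^\infty)}$, of the linear span of the monomials $z^\alpha$, $\alpha\in\mathbb N_0^{(\mathbb N)}$. -/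

import Mathlib

open MeasureTheory
open scoped ENNReal

noncomputable section

namespace HardyInf

/-- The Borel `σ`-algebra on the unit circle `𝕋`. -/
instance instMeasurableSpaceCircle : MeasurableSpace Circle := borel Circle

instance instBorelSpaceCircle : BorelSpace Circle := ⟨rfl⟩

/-- The normalized Haar (Lebesgue) measure on the unit circle `𝕋`. -/
def circleMeasure : Measure Circle := Measure.haarMeasure ⊤

instance instIsProbabilityMeasureCircle : IsProbabilityMeasure circleMeasure :=
  ⟨Measure.haarMeasure_self⟩

/-- The product measure `m_n` on the polytorus `𝕋ⁿ`. -/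
abbrev torusMeasureFin (n : ℕ) : Measure (Fin n → Circle) :=
  Measure.pi fun _ => circleMeasure

/-- The product measure `m` on the infinite dimensional polytorus `𝕋^∞`. -/
abbrev torusMeasure : Measure (ℕ → Circle) :=
  Measure.infinitePi fun _ => circleMeasure

/-- The character `w ↦ w^α = ∏ w_i^{α_i}` of `𝕋^∞`, for a finitely supported integer
multi-index `α`. -/
def torusMonomial (α : ℕ →₀ ℤ) (w : ℕ → Circle) : Circle :=
  α.prod fun i k => w i ^ k

/-- The Fourier coefficient `∫ f(w) w^{-α} dm(w)`. -/
def fourierCoeff (f : (ℕ → Circle) → ℂ) (α : ℕ →₀ ℤ) : ℂ :=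
  ∫ w, f w * (torusMonomial (-α) w : ℂ) ∂torusMeasure

/-- A natural multi-index regarded as an integer multi-index. -/
def natIndex (α : ℕ →₀ ℕ) : ℕ →₀ ℤ :=
  α.mapRange (fun k : ℕ => (k : ℤ)) Nat.cast_zero

theorem continuous_torusMonomial (α : ℕ →₀ ℤ) :
    Continuous fun w : ℕ → Circle => (torusMonomial α w : ℂ) := by
  have h : Continuous fun w : ℕ → Circle => ∏ i ∈ α.support, w i ^ α i := by fun_prop
  exact continuous_subtype_val.comp h

theorem integrable_mul_torusMonomial {p : ℝ≥0∞} [Fact (1 ≤ p)] (f : Lp ℂ p torusMeasure)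
    (α : ℕ →₀ ℤ) :
    Integrable (fun w => f w * (torusMonomial α w : ℂ)) torusMeasure := by
  have hf : Integrable f torusMeasure := (Lp.memLp f).integrable Fact.out
  refine hf.mul_bdd (c := 1) ?_ ?_
  · exact (continuous_torusMonomial α).aestronglyMeasurable
  · exact Filter.Eventually.of_forall fun w => (Circle.norm_coe _).le

/-- The Hardy space `H_p(𝕋^∞)`: the functions in `L_p(𝕋^∞)` all of whose Fourier coefficients
with an index outside `ℕ₀^(ℕ)` vanish.  It carries the norm of `L_p(𝕋^∞)`. -/
def HpTorus (p : ℝ≥0∞) [Fact (1 ≤ p)] : Submodule ℂ (Lp ℂ p torusMeasure) where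
  carrier := {f | ∀ α : ℕ →₀ ℤ, (∃ i, α i < 0) → fourierCoeff f α = 0}
  zero_mem' := fun α _ => by
    have h : (fun w => (0 : Lp ℂ p torusMeasure) w * (torusMonomial (-α) w : ℂ))
        =ᵐ[torusMeasure] fun _ => 0 := by
      filter_upwards [Lp.coeFn_zero ℂ p torusMeasure] with w hw
      rw [hw, Pi.zero_apply, zero_mul]
    rw [fourierCoeff, integral_congr_ae h, integral_zero]
  add_mem' := fun {f g} hf hg α hα => by
    have h : (fun w => (f + g : Lp ℂ p torusMeasure) w * (torusMonomial (-α) w : ℂ))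
        =ᵐ[torusMeasure] fun w => f w * (torusMonomial (-α) w : ℂ)
          + g w * (torusMonomial (-α) w : ℂ) := by
      filter_upwards [Lp.coeFn_add f g] with w hw
      rw [hw, Pi.add_apply, add_mul]
    have h1 := hf α hα
    have h2 := hg α hα
    rw [fourierCoeff] at h1 h2 ⊢
    rw [integral_congr_ae h, integral_add (integrable_mul_torusMonomial f _)
      (integrable_mul_torusMonomial g _), h1, h2, add_zero]
  smul_mem' := fun c f hf α hα => by
    have h : (fun w => (c • f : Lp ℂ p torusMeasure) w * (torusMonomial (-α) w : ℂ))
        =ᵐ[torusMeasure] fun w => c * (f w * (torusMonomial (-α) w : ℂ)) := by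
      filter_upwards [Lp.coeFn_smul c f] with w hw
      rw [hw, Pi.smul_apply, smul_eq_mul, mul_assoc]
    have h1 := hf α hα
    rw [fourierCoeff] at h1 ⊢
    rw [integral_congr_ae h, integral_const_mul, h1, mul_zero]

/-- The complex Hilbert space `ℓ₂`. -/
abbrev ellTwo : Type := lp (fun _ : ℕ => ℂ) 2

/-- The domain `𝔻^∞ ∩ ℓ₂`, as a subset of `ℓ₂`.  (An element of `ℓ₂` is a null sequence, so
`|z_i| < 1` for all `i` is the same as `sup_i |z_i| < 1`.) -/
def polydisc : Set ellTwo := {z | ∀ i, ‖z i‖ < 1}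

/-- A function on `𝔻^∞ ∩ ℓ₂` is holomorphic if it is complex Fréchet differentiable with
respect to the norm of `ℓ₂`. -/
def IsHolomorphic (g : polydisc → ℂ) : Prop :=
  ∃ G : ellTwo → ℂ, DifferentiableOn ℂ G polydisc ∧ ∀ z : polydisc, G z = g z

/-- The point `(a_1, …, a_n, 0, 0, …)` of `ℓ₂`. -/
def finPoint {n : ℕ} (a : Fin n → ℂ) : ellTwo :=
  ∑ i : Fin n, lp.single 2 (i : ℕ) (a i)

theorem finPoint_apply {n : ℕ} (a : Fin n → ℂ) (k : ℕ) :
    finPoint a k = if h : k < n then a ⟨k, h⟩ else 0 := by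
  unfold finPoint
  rw [lp.coeFn_sum, Finset.sum_apply]
  split_ifs with h
  · rw [Finset.sum_eq_single ⟨k, h⟩]
    · simp
    · intro b _ hb
      have : k ≠ (b : ℕ) := fun h' => hb (Fin.ext h'.symm)
      simp [this]
    · simp
  · refine Finset.sum_eq_zero fun b _ => ?_
    have : k ≠ (b : ℕ) := fun h' => h (h' ▸ b.2)
    simp [this]

theorem finPoint_mem {n : ℕ} {a : Fin n → ℂ} (ha : ∀ i, ‖a i‖ < 1) :
    finPoint a ∈ polydisc := by
  intro k
  rw [finPoint_apply]
  split_ifs with h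
  · exact ha _
  · simp

theorem norm_radius_mul_lt {n : ℕ} (r : Set.Ioo (0 : ℝ) 1) (w : Fin n → Circle) (i : Fin n) :
    ‖((r : ℝ) : ℂ) * (w i : ℂ)‖ < 1 := by
  rw [norm_mul, Circle.norm_coe, mul_one, Complex.norm_real, Real.norm_of_nonneg r.2.1.le]
  exact r.2.2

/-- The point `(r w_1, …, r w_n, 0, 0, …)` of `𝔻^∞ ∩ ℓ₂`. -/
def torusPoint {n : ℕ} (r : Set.Ioo (0 : ℝ) 1) (w : Fin n → Circle) : polydisc :=
  ⟨finPoint fun i => ((r : ℝ) : ℂ) * (w i : ℂ), finPoint_mem (norm_radius_mul_lt r w)⟩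

/-- The quantity `sup_n sup_{0<r<1} (∫_{𝕋ⁿ} |g(r w_1, …, r w_n, 0, …)|^p dm_n(w))^{1/p}`,
possibly infinite.  (For `n = 0` the integral is `|g(0)|^p`, which for holomorphic `g` does not
exceed the integrals for `n ≥ 1`.) -/
def hpNorm (p : ℝ≥0∞) (g : polydisc → ℂ) : ℝ≥0∞ :=
  ⨆ (n : ℕ) (r : Set.Ioo (0 : ℝ) 1),
    eLpNorm (fun w : Fin n → Circle => g (torusPoint r w)) p (torusMeasureFin n)

theorem eLpNorm_le_hpNorm (p : ℝ≥0∞) (g : polydisc → ℂ) (n : ℕ) (r : Set.Ioo (0 : ℝ) 1) :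
    eLpNorm (fun w : Fin n → Circle => g (torusPoint r w)) p (torusMeasureFin n) ≤ hpNorm p g :=
  le_iSup₂ (f := fun (n : ℕ) (r : Set.Ioo (0 : ℝ) 1) =>
    eLpNorm (fun w : Fin n → Circle => g (torusPoint r w)) p (torusMeasureFin n)) n r

theorem continuous_finPoint {n : ℕ} : Continuous fun a : Fin n → ℂ => finPoint a := by
  unfold finPoint
  refine continuous_finsetSum _ fun i _ => ?_
  exact (lp.isometry_single (E := fun _ : ℕ => ℂ) (p := 2) (i : ℕ)).continuous.comp
    (continuous_apply i)

theorem IsHolomorphic.continuous {g : polydisc → ℂ} (hg : IsHolomorphic g) : Continuous g := by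
  obtain ⟨G, hG, h⟩ := hg
  have : g = polydisc.domRestrict G := funext fun z => (h z).symm
  rw [this]
  exact hG.continuousOn.domRestrict

theorem continuous_torusPoint {n : ℕ} (r : Set.Ioo (0 : ℝ) 1) :
    Continuous fun w : Fin n → Circle => torusPoint r w := by
  refine Continuous.subtype_mk (continuous_finPoint.comp ?_) _
  fun_prop

theorem IsHolomorphic.aestronglyMeasurable {g : polydisc → ℂ} (hg : IsHolomorphic g) {n : ℕ}
    (r : Set.Ioo (0 : ℝ) 1) :
    AEStronglyMeasurable (fun w : Fin n → Circle => g (torusPoint r w)) (torusMeasureFin n) :=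
  (hg.continuous.comp (continuous_torusPoint r)).aestronglyMeasurable

theorem IsHolomorphic.zero : IsHolomorphic 0 := ⟨0, by fun_prop, fun _ => rfl⟩

theorem IsHolomorphic.add {g h : polydisc → ℂ} (hg : IsHolomorphic g) (hh : IsHolomorphic h) :
    IsHolomorphic (g + h) := by
  obtain ⟨G, hG, h1⟩ := hg
  obtain ⟨H, hH, h2⟩ := hh
  exact ⟨G + H, hG.add hH, fun z => by simp [h1, h2]⟩

theorem IsHolomorphic.smul {g : polydisc → ℂ} (c : ℂ) (hg : IsHolomorphic g) :
    IsHolomorphic (c • g) := by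
  obtain ⟨G, hG, h1⟩ := hg
  exact ⟨c • G, hG.const_smul c, fun z => by simp [h1]⟩

theorem hpNorm_zero (p : ℝ≥0∞) : hpNorm p 0 = 0 := by
  simp [hpNorm]

theorem hpNorm_add_le {p : ℝ≥0∞} [hp : Fact (1 ≤ p)] {g h : polydisc → ℂ}
    (hg : IsHolomorphic g) (hh : IsHolomorphic h) :
    hpNorm p (g + h) ≤ hpNorm p g + hpNorm p h := by
  refine iSup₂_le fun n r => ?_
  refine (eLpNorm_add_le (hg.aestronglyMeasurable r) (hh.aestronglyMeasurable r) hp.out).trans ?_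
  exact add_le_add (eLpNorm_le_hpNorm p g n r) (eLpNorm_le_hpNorm p h n r)

theorem hpNorm_smul (p : ℝ≥0∞) (c : ℂ) (g : polydisc → ℂ) :
    hpNorm p (c • g) = ‖c‖ₑ * hpNorm p g := by
  simp only [hpNorm, ENNReal.mul_iSup]
  refine iSup_congr fun n => iSup_congr fun r => ?_
  exact eLpNorm_const_smul c (fun w : Fin n → Circle => g (torusPoint r w)) p _

/-- The underlying vector space of `H_p(𝔻^∞)`: the holomorphic functions on `𝔻^∞ ∩ ℓ₂` with
finite `hpNorm`. -/
def hpSubmodule (p : ℝ≥0∞) [Fact (1 ≤ p)] : Submodule ℂ (polydisc → ℂ) where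
  carrier := {g | IsHolomorphic g ∧ hpNorm p g < ∞}
  zero_mem' := ⟨IsHolomorphic.zero, by simp [hpNorm_zero]⟩
  add_mem' := fun hg hh =>
    ⟨hg.1.add hh.1, (hpNorm_add_le hg.1 hh.1).trans_lt (ENNReal.add_lt_top.2 ⟨hg.2, hh.2⟩)⟩
  smul_mem' := fun c g hg =>
    ⟨hg.1.smul c, by rw [hpNorm_smul]; exact ENNReal.mul_lt_top (by simp) hg.2⟩

/-- The Hardy space `H_p(𝔻^∞)` of holomorphic functions on `𝔻^∞ ∩ ℓ₂`. -/
def HpDisc (p : ℝ≥0∞) [Fact (1 ≤ p)] : Type := hpSubmodule p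

instance instAddCommGroupHpDisc (p : ℝ≥0∞) [Fact (1 ≤ p)] : AddCommGroup (HpDisc p) :=
  inferInstanceAs (AddCommGroup (hpSubmodule p))

instance instModuleHpDisc (p : ℝ≥0∞) [Fact (1 ≤ p)] : Module ℂ (HpDisc p) :=
  inferInstanceAs (Module ℂ (hpSubmodule p))

instance instCoeFunHpDisc (p : ℝ≥0∞) [Fact (1 ≤ p)] :
    CoeFun (HpDisc p) fun _ => polydisc → ℂ := ⟨fun g => g.1⟩

instance instIsHaarMeasureCircle : circleMeasure.IsHaarMeasure := by
  unfold circleMeasure; infer_instance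

theorem torusPoint_eq_zero {p : ℝ≥0∞} [hp : Fact (1 ≤ p)] {g : polydisc → ℂ}
    (hg : IsHolomorphic g) (h0 : hpNorm p g = 0) {n : ℕ} (r : Set.Ioo (0 : ℝ) 1)
    (w : Fin n → Circle) : g (torusPoint r w) = 0 := by
  have h1 : eLpNorm (fun w : Fin n → Circle => g (torusPoint r w)) p (torusMeasureFin n) = 0 :=
    le_antisymm ((eLpNorm_le_hpNorm p g n r).trans h0.le) bot_le
  rw [eLpNorm_eq_zero_iff (hg.aestronglyMeasurable r) (zero_lt_one.trans_le hp.out).ne'] at h1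
  have hc : Continuous fun w : Fin n → Circle => g (torusPoint r w) :=
    hg.continuous.comp (continuous_torusPoint r)
  exact congrFun (MeasureTheory.Measure.eq_of_ae_eq h1 hc continuous_const) w

theorem finPoint_eq_zero {p : ℝ≥0∞} [Fact (1 ≤ p)] {g : polydisc → ℂ} {G : ellTwo → ℂ}
    (hG : DifferentiableOn ℂ G polydisc) (hGg : ∀ z : polydisc, G z = g z)
    (h0 : hpNorm p g = 0) {n : ℕ} (r : Set.Ioo (0 : ℝ) 1) (s : Finset (Fin n)) :
    ∀ a : Fin n → ℂ, (∀ i ∈ s, ‖a i‖ ≤ r) → (∀ i ∉ s, ‖a i‖ = r) → G (finPoint a) = 0 := by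
  have hr0 : (0 : ℝ) < r := r.2.1
  induction s using Finset.induction_on with
  | empty =>
    intro a _ ha
    have hn : ∀ i, ‖a i / ((r : ℝ) : ℂ)‖ = 1 := fun i => by
      rw [norm_div, ha i (by simp), Complex.norm_real, Real.norm_of_nonneg hr0.le,
        div_self hr0.ne']
    let w : Fin n → Circle := fun i => ⟨a i / ((r : ℝ) : ℂ),
      mem_sphere_zero_iff_norm.2 (hn i)⟩
    have h1 := torusPoint_eq_zero ⟨G, hG, hGg⟩ h0 r w
    rw [← hGg] at h1
    have h2 : ((torusPoint r w : polydisc) : ellTwo) = finPoint a := by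
      change finPoint _ = finPoint a
      congr 1
      funext i
      exact mul_div_cancel₀ (a i) (Complex.ofReal_ne_zero.2 hr0.ne')
    rwa [h2] at h1
  | insert k s hk ih =>
    intro a ha hb
    have key : Set.EqOn (fun t : ℂ => G (finPoint (Function.update a k t))) (fun _ => 0)
        (closure (Metric.ball 0 (r : ℝ))) := by
      refine Complex.eqOn_closure_of_eqOn_frontier Metric.isBounded_ball ?_
        diffContOnCl_const ?_
      · refine DifferentiableOn.diffContOnCl ?_
        rw [closure_ball _ hr0.ne']
        refine hG.comp (f := fun t : ℂ => finPoint (Function.update a k t)) ?_ ?_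
        · refine Differentiable.differentiableOn ?_
          unfold finPoint
          refine Differentiable.fun_sum fun i _ => ?_
          have h1 : Differentiable ℂ fun t : ℂ => Function.update a k t i := by
            by_cases hik : i = k
            · subst hik; simp
            · simp [Function.update_of_ne hik]
          exact (lp.singleContinuousLinearMap ℂ (fun _ : ℕ => ℂ) 2 (i : ℕ)).differentiable.comp h1
        · intro t ht
          refine finPoint_mem fun i => ?_
          refine lt_of_le_of_lt ?_ r.2.2
          by_cases hik : i = k
          · subst hik; simpa using ht
          · rw [Function.update_of_ne hik]
            by_cases his : i ∈ insert k s
            · exact ha i his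
            · exact (hb i his).le
      · intro t ht
        rw [frontier_ball _ hr0.ne'] at ht
        refine ih _ (fun i hi => ?_) (fun i hi => ?_)
        · have hik : i ≠ k := fun h => hk (h ▸ hi)
          rw [Function.update_of_ne hik]
          exact ha i (Finset.mem_insert_of_mem hi)
        · by_cases hik : i = k
          · subst hik; simpa using ht
          · rw [Function.update_of_ne hik]
            exact hb i (by simp [hik, hi])
    have h1 := key (x := a k) (by
      rw [closure_ball _ hr0.ne']
      simpa using ha k (Finset.mem_insert_self k s))
    simpa using h1

theorem eq_zero_of_hpNorm_eq_zero {p : ℝ≥0∞} [Fact (1 ≤ p)] {g : polydisc → ℂ}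
    (hg : IsHolomorphic g) (h0 : hpNorm p g = 0) : g = 0 := by
  obtain ⟨G, hG, hGg⟩ := hg
  funext z
  have hz : ∀ n : ℕ, G (finPoint fun i : Fin n => (z : ellTwo) i) = 0 := fun n => by
    have h1 : ∀ᶠ r : ℝ in nhdsWithin 1 (Set.Iio 1), ∀ i : Fin n, ‖(z : ellTwo) i‖ ≤ r :=
      Filter.eventually_all.2 fun i =>
        ((lt_mem_nhds (z.2 i)).filter_mono nhdsWithin_le_nhds).mono fun _ h => h.le
    have h2 : ∀ᶠ r : ℝ in nhdsWithin 1 (Set.Iio 1), 0 < r :=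
      (lt_mem_nhds zero_lt_one).filter_mono nhdsWithin_le_nhds
    obtain ⟨r, hr, hr0, hr1⟩ := (h1.and (h2.and self_mem_nhdsWithin)).exists
    exact finPoint_eq_zero hG hGg h0 ⟨r, hr0, hr1⟩ Finset.univ _ (fun i _ => hr i)
      (fun i hi => absurd (Finset.mem_univ i) hi)
  have hlim : Filter.Tendsto (fun n : ℕ => finPoint fun i : Fin n => (z : ellTwo) i) Filter.atTop
      (nhds (z : ellTwo)) := by
    have h1 := (lp.hasSum_single (E := fun _ : ℕ => ℂ) (p := 2) (by simp)
      (z : ellTwo)).tendsto_sum_nat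
    refine h1.congr fun n => ?_
    exact (Fin.sum_univ_eq_sum_range
      (fun i => lp.single (E := fun _ : ℕ => ℂ) 2 i ((z : ellTwo) i)) n).symm
  have hmem : ∀ n : ℕ, (finPoint fun i : Fin n => (z : ellTwo) i) ∈ polydisc := fun n =>
    finPoint_mem fun i => z.2 i
  have hc : Filter.Tendsto (fun n : ℕ => G (finPoint fun i : Fin n => (z : ellTwo) i)) Filter.atTop
      (nhds (G z)) :=
    (hG.continuousOn z z.2).tendsto.comp
      (tendsto_nhdsWithin_iff.2 ⟨hlim, Filter.Eventually.of_forall hmem⟩)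
  simp only [hz] at hc
  rw [← hGg z, Pi.zero_apply]
  exact tendsto_nhds_unique hc tendsto_const_nhds

theorem hpNorm_neg (p : ℝ≥0∞) (g : polydisc → ℂ) : hpNorm p (-g) = hpNorm p g := by
  have h := hpNorm_smul p (-1) g
  simpa using h

/-- `H_p(𝔻^∞)` with the norm
`‖g‖ = sup_n sup_{0<r<1} (∫_{𝕋ⁿ} |g(r w_1, …, r w_n, 0, …)|^p dm_n(w))^{1/p}`. -/
instance instNormedAddCommGroupHpDisc (p : ℝ≥0∞) [Fact (1 ≤ p)] :
    NormedAddCommGroup (HpDisc p) :=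
  AddGroupNorm.toNormedAddCommGroup
    { toFun := fun g => (hpNorm p g).toReal
      map_zero' := by
        change (hpNorm p 0).toReal = 0
        rw [hpNorm_zero, ENNReal.toReal_zero]
      add_le' := fun g h => by
        rw [← ENNReal.toReal_add g.2.2.ne h.2.2.ne]
        exact ENNReal.toReal_mono (ENNReal.add_ne_top.2 ⟨g.2.2.ne, h.2.2.ne⟩)
          (hpNorm_add_le g.2.1 h.2.1)
      neg' := fun g => congrArg ENNReal.toReal (hpNorm_neg p g)
      eq_zero_of_map_eq_zero' := fun g hg => by
        rcases (ENNReal.toReal_eq_zero_iff _).1 hg with h | h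
        · exact Subtype.ext (eq_zero_of_hpNorm_eq_zero g.2.1 h)
        · exact absurd h g.2.2.ne }

theorem norm_hpDisc_def {p : ℝ≥0∞} [Fact (1 ≤ p)] (g : HpDisc p) :
    ‖g‖ = (hpNorm p g).toReal := rfl

instance instNormedSpaceHpDisc (p : ℝ≥0∞) [Fact (1 ≤ p)] : NormedSpace ℂ (HpDisc p) where
  norm_smul_le c g := by
    have h : hpNorm p (c • g : HpDisc p) = ‖c‖ₑ * hpNorm p g := hpNorm_smul p c g
    rw [norm_hpDisc_def, norm_hpDisc_def, h, ENNReal.toReal_mul, toReal_enorm]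

/-- The monomial `z^α = ∏ z_i^{α_i}` on `𝔻^∞ ∩ ℓ₂`. -/
def discMonomial (α : ℕ →₀ ℕ) (z : polydisc) : ℂ :=
  α.prod fun i k => (z : ellTwo) i ^ k

theorem isHolomorphic_discMonomial (α : ℕ →₀ ℕ) : IsHolomorphic (discMonomial α) := by
  refine ⟨fun z => ∏ i ∈ α.support, z i ^ α i, ?_, fun z => rfl⟩
  have h : ∀ i, Differentiable ℂ fun z : ellTwo => z i := fun i =>
    (lp.evalCLM ℂ (fun _ : ℕ => ℂ) 2 i).differentiable
  have h2 : Differentiable ℂ fun z : ellTwo => ∏ i ∈ α.support, z i ^ α i :=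
    fun z => (HasFDerivAt.finsetProd fun i _ =>
      ((h i).fun_pow (α i) z).hasFDerivAt).differentiableAt
  exact h2.differentiableOn

theorem norm_discMonomial_le (α : ℕ →₀ ℕ) (z : polydisc) : ‖discMonomial α z‖ ≤ 1 := by
  rw [discMonomial, Finsupp.prod, norm_prod]
  refine Finset.prod_le_one (fun _ _ => norm_nonneg _) fun i _ => ?_
  rw [norm_pow]
  exact pow_le_one₀ (norm_nonneg _) (z.2 i).le

theorem hpNorm_discMonomial_lt (p : ℝ≥0∞) (α : ℕ →₀ ℕ) : hpNorm p (discMonomial α) < ∞ := by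
  refine lt_of_le_of_lt (b := 1) (iSup₂_le fun n r => ?_) ENNReal.one_lt_top
  refine (eLpNorm_le_of_ae_bound (C := 1)
    (Filter.Eventually.of_forall fun w => norm_discMonomial_le α _)).trans ?_
  simp

/-- The monomial `z^α` as an element of `H_p(𝔻^∞)`. -/
def hpMonomial (p : ℝ≥0∞) [Fact (1 ≤ p)] (α : ℕ →₀ ℕ) : HpDisc p :=
  ⟨discMonomial α, isHolomorphic_discMonomial α, hpNorm_discMonomial_lt p α⟩

end HardyInf

end

/-!
The coefficients of an analytic polynomial `P` in one variable satisfy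
`∑ |P_k| ρ^k ≤ (1 + O(ρ²)) ∫ |P|`, the absence of a term of order `ρ` being the point. Integrating
out one variable after the other, this bounds `∑ |f̂(α)| |z^α|` by `‖f‖ ∏ (1 + O(|z_i|²))` for
analytic polynomials `f`, and the product converges for `z ∈ ℓ₂`. As analytic polynomials are dense
in `H_p(𝕋^∞)`, the series `φ(f)` converges absolutely for all `f`, and `φ(f)` is a locally uniform
limit of polynomials, hence holomorphic.

The restriction of `φ(f)` to a torus of radius `r` is the convolution of `f` with a product of
Poisson measures. Such a convolution is a contraction of `L_p`, and it tends to `f` as `r → 1` and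
the number of variables tends to infinity; so `φ` is isometric, and by density its range is the
closed span of the monomials.

For `1 < p < ∞` the space `L_p` is uniformly convex, so the closed convex hulls of the tails of a
bounded sequence have a common point. Applied to the restrictions of `g ∈ H_p(𝔻^∞)` to tori with
`r → 1`, this gives an `f` whose Fourier coefficients are the limits of those of the restrictions.
The latter depend on the radii only through the factor `∏ r_i^|α_i|`, by the Poisson formula in each
variable, and therefore `φ(f)` and `g` agree on all these tori, which determine them.
-/

noncomputable section

namespace HardyInf

/-! ### Convolution operators and characters -/

theorem integrable_of_continuous {X E : Type*} [TopologicalSpace X] [CompactSpace X]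
    [MeasurableSpace X] [OpensMeasurableSpace X] [NormedAddCommGroup E]
    {μ : Measure X} [IsFiniteMeasureOnCompacts μ] {u : X → E}
    (hu : Continuous u) : Integrable u μ :=
  hu.integrable_of_hasCompactSupport (HasCompactSupport.of_compactSpace u)

section TranslateIntegral

variable {G : Type*} [Group G] [TopologicalSpace G] [IsTopologicalGroup G] [MeasurableSpace G]
  [BorelSpace G] {μ : Measure G} [μ.IsMulLeftInvariant] {p : ℝ≥0∞} [Fact (1 ≤ p)]

theorem norm_integral_smul_translate_le [CompactSpace G] (b : C(G, ℂ)) (ν : Measure G)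
    [IsProbabilityMeasure ν] (f : Lp ℂ p μ) :
    ‖∫ v, b v • DomMulAct.mk v • f ∂ν‖ ≤ ‖b‖ * ‖f‖ := by
  have h : ∀ v, ‖b v • DomMulAct.mk v • f‖ ≤ ‖b‖ * ‖f‖ := fun v => by
    rw [norm_smul, DomMulAct.norm_smul_Lp]
    gcongr
    exact b.norm_coe_le_norm v
  simpa using norm_integral_le_of_norm_le_const (μ := ν) (.of_forall h)

variable [IsFiniteMeasure μ] [μ.InnerRegularCompactLTTop] [Fact (p ≠ ∞)]

theorem continuous_translate (f : Lp ℂ p μ) : Continuous fun v : G => DomMulAct.mk v • f :=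
  DomMulAct.continuous_mk.smul continuous_const

variable [CompactSpace G]

theorem integrable_smul_translate (b : C(G, ℂ)) (ν : Measure G) [IsFiniteMeasure ν]
    (f : Lp ℂ p μ) : Integrable (fun v => b v • DomMulAct.mk v • f) ν :=
  integrable_of_continuous (b.continuous.smul (continuous_translate f))

/-- The operator `f ↦ ∫ b(v) f(v ·) dν(v)` of `L_p`, that is, convolution with the measure `b ν`
up to an inversion of the variable. -/
def translateIntegral (b : C(G, ℂ)) (ν : Measure G) [IsProbabilityMeasure ν] :
    Lp ℂ p μ →L[ℂ] Lp ℂ p μ :=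
  LinearMap.mkContinuous
    { toFun := fun f => ∫ v, b v • DomMulAct.mk v • f ∂ν
      map_add' := fun f g => by
        simp only [smul_add]
        exact integral_add (integrable_smul_translate b ν f) (integrable_smul_translate b ν g)
      map_smul' := fun c f => by
        simp only [smul_comm _ c f, smul_comm _ c (_ : Lp ℂ p μ), integral_smul, RingHom.id_apply] }
    ‖b‖ (norm_integral_smul_translate_le b ν)

theorem translateIntegral_apply (b : C(G, ℂ)) (ν : Measure G) [IsProbabilityMeasure ν]
    (f : Lp ℂ p μ) : translateIntegral b ν f = ∫ v, b v • DomMulAct.mk v • f ∂ν := rfl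

theorem norm_translateIntegral_le (b : C(G, ℂ)) (ν : Measure G) [IsProbabilityMeasure ν] :
    ‖(translateIntegral b ν : Lp ℂ p μ →L[ℂ] Lp ℂ p μ)‖ ≤ ‖b‖ :=
  LinearMap.mkContinuous_norm_le _ (norm_nonneg b) _

end TranslateIntegral

theorem torusMonomial_mul (α : ℕ →₀ ℤ) (w v : ℕ → Circle) :
    torusMonomial α (w * v) = torusMonomial α w * torusMonomial α v := by
  simp [torusMonomial, Finsupp.prod, mul_zpow, Finset.prod_mul_distrib]

theorem torusMonomial_zero (w : ℕ → Circle) : torusMonomial 0 w = 1 := by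
  simp [torusMonomial]

theorem torusMonomial_add (α β : ℕ →₀ ℤ) (w : ℕ → Circle) :
    torusMonomial (α + β) w = torusMonomial α w * torusMonomial β w :=
  Finsupp.prod_add_index' (by simp) fun _ _ _ => zpow_add _ _ _

theorem torusMonomial_neg (α : ℕ →₀ ℤ) (w : ℕ → Circle) :
    torusMonomial (-α) w = (torusMonomial α w)⁻¹ := by
  rw [eq_inv_iff_mul_eq_one, ← torusMonomial_add, neg_add_cancel, torusMonomial_zero]

/-- The character `w ↦ w^α` as a continuous function. -/
def torusChar (α : ℕ →₀ ℤ) : C(ℕ → Circle, ℂ) :=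
  ⟨fun w => (torusMonomial α w : ℂ), continuous_torusMonomial α⟩

theorem torusChar_apply (α : ℕ →₀ ℤ) (w : ℕ → Circle) : torusChar α w = torusMonomial α w := rfl

theorem torusChar_zero : torusChar 0 = 1 := by
  ext w
  simp [torusChar_apply, torusMonomial_zero]

theorem torusChar_add (α β : ℕ →₀ ℤ) : torusChar (α + β) = torusChar α * torusChar β := by
  ext w
  simp [torusChar_apply, torusMonomial_add]

theorem star_torusChar (α : ℕ →₀ ℤ) : star (torusChar α) = torusChar (-α) := by
  ext w
  rw [ContinuousMap.star_apply, torusChar_apply, torusChar_apply, torusMonomial_neg,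
    Circle.coe_inv_eq_conj, RCLike.star_def]

/-- The algebra of trigonometric polynomials on `𝕋^∞`. -/
def trigSubalgebra : StarSubalgebra ℂ C(ℕ → Circle, ℂ) where
  toSubalgebra := Algebra.adjoin ℂ (Set.range torusChar)
  star_mem' := by
    change Algebra.adjoin ℂ (Set.range torusChar) ≤ star (Algebra.adjoin ℂ (Set.range torusChar))
    refine Algebra.adjoin_le ?_
    rintro _ ⟨α, rfl⟩
    exact Algebra.subset_adjoin ⟨-α, (star_torusChar α).symm⟩

theorem toSubmodule_trigSubalgebra :
    Subalgebra.toSubmodule trigSubalgebra.toSubalgebra =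
      Submodule.span ℂ (Set.range torusChar) := by
  refine Algebra.adjoin_eq_span_of_subset _ (Set.Subset.trans ?_ Submodule.subset_span)
  intro x hx
  refine Submonoid.closure_induction (fun _ => id) ⟨0, torusChar_zero⟩ ?_ hx
  rintro _ _ _ _ ⟨α, rfl⟩ ⟨β, rfl⟩
  exact ⟨α + β, torusChar_add α β⟩

theorem trigSubalgebra_separatesPoints : trigSubalgebra.SeparatesPoints := by
  intro w v hwv
  obtain ⟨i, hi⟩ := Function.ne_iff.1 hwv
  refine ⟨_, ⟨torusChar (Finsupp.single i 1), Algebra.subset_adjoin ⟨_, rfl⟩, rfl⟩, ?_⟩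
  intro h
  refine hi (Circle.ext ?_)
  simpa [torusChar_apply, torusMonomial] using h

theorem topologicalClosure_span_torusChar :
    (Submodule.span ℂ (Set.range torusChar)).topologicalClosure = ⊤ := by
  rw [← toSubmodule_trigSubalgebra]
  exact congrArg (Subalgebra.toSubmodule <| StarSubalgebra.toSubalgebra ·)
    (ContinuousMap.starSubalgebra_topologicalClosure_eq_top_of_separatesPoints trigSubalgebra
      trigSubalgebra_separatesPoints)

instance instIsMulLeftInvariantTorus : torusMeasure.IsMulLeftInvariant where
  map_mul_left_eq_self g := by
    refine (Measure.infinitePi_map_pi (μ := fun _ : ℕ => circleMeasure)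
      (f := fun i x => g i * x) fun i => by fun_prop).trans ?_
    simp only [map_mul_left_eq_self]

theorem torusChar_eq_prod (α : ℕ →₀ ℤ) (w : ℕ → Circle) :
    torusChar α w = ∏ i ∈ α.support, (w i : ℂ) ^ α i :=
  (map_prod Circle.coeHom _ _).trans (Finset.prod_congr rfl fun _ _ => Circle.coe_zpow _ _)

theorem integral_torusChar_infinitePi (ν : ℕ → Measure Circle) [∀ i, IsProbabilityMeasure (ν i)]
    (α : ℕ →₀ ℤ) : ∫ v, torusChar α v ∂(Measure.infinitePi ν) =
      ∏ i ∈ α.support, ∫ v : Circle, (v : ℂ) ^ α i ∂(ν i) := by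
  let F : (α.support → Circle) → ℂ := fun y => ∏ i, (y i : ℂ) ^ α i
  have hF : Continuous F := by
    have h : ∀ y, F y = ∏ i, ((y i ^ α i : Circle) : ℂ) := fun y => by
      simp only [F, Circle.coe_zpow]
    simp only [funext h]
    exact continuous_finsetProd _ fun i _ =>
      continuous_subtype_val.comp ((continuous_apply i).zpow (α i))
  have hα : ∀ v : ℕ → Circle, torusChar α v = F (α.support.restrict v) := fun v => by
    rw [torusChar_eq_prod]
    exact (Finset.prod_coe_sort α.support fun i => (v i : ℂ) ^ α i).symm
  calc ∫ v, torusChar α v ∂(Measure.infinitePi ν)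
      = ∫ v, F (α.support.restrict v) ∂(Measure.infinitePi ν) :=
        integral_congr_ae (.of_forall hα)
    _ = ∫ y, F y ∂(Measure.pi fun i : α.support => ν i) :=
        integral_restrict_infinitePi ν hF.aestronglyMeasurable
    _ = ∏ i : α.support, ∫ v : Circle, (v : ℂ) ^ α i ∂(ν i) :=
        integral_fintype_prod_eq_prod fun (i : α.support) (v : Circle) => (v : ℂ) ^ α i
    _ = ∏ i ∈ α.support, ∫ v : Circle, (v : ℂ) ^ α i ∂(ν i) :=
        Finset.prod_coe_sort α.support fun i => ∫ v : Circle, (v : ℂ) ^ α i ∂(ν i)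

theorem fourierCoeff_congr {f g : (ℕ → Circle) → ℂ} (h : f =ᵐ[torusMeasure] g) (α : ℕ →₀ ℤ) :
    fourierCoeff f α = fourierCoeff g α :=
  integral_congr_ae (h.mono fun w hw => by simp only [hw])

theorem integral_zpow_circle {k : ℤ} (hk : k ≠ 0) :
    ∫ v : Circle, (v : ℂ) ^ k ∂circleMeasure = 0 := by
  have hc : (Circle.exp (Real.pi / k) : ℂ) ^ k = -1 := by
    rw [← Circle.coe_zpow, ← Circle.exp_zsmul, zsmul_eq_mul,
      mul_div_cancel₀ _ (Int.cast_ne_zero.2 hk)]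
    simp
  have h := integral_mul_left_eq_self (μ := circleMeasure)
    (fun v : Circle => (v : ℂ) ^ k) (Circle.exp (Real.pi / k))
  simp only [Circle.coe_mul, mul_zpow, hc, neg_mul, one_mul, integral_neg] at h
  exact self_eq_neg.1 h.symm

theorem fourierCoeff_torusChar (α β : ℕ →₀ ℤ) :
    fourierCoeff (torusChar α) β = if α = β then 1 else 0 := by
  have h : fourierCoeff (torusChar α) β = ∫ w, torusChar (α - β) w ∂torusMeasure := by
    simp only [fourierCoeff, sub_eq_add_neg, torusChar_add]
    rfl
  rw [h]
  split_ifs with hαβ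
  · simp [hαβ, torusChar_zero]
  · obtain ⟨i, hi⟩ := Finsupp.ne_iff.1 (sub_ne_zero.2 hαβ)
    rw [integral_torusChar_infinitePi]
    exact Finset.prod_eq_zero (Finsupp.mem_support_iff.2 hi) (integral_zpow_circle hi)

theorem integral_norm_le_norm_Lp {X E : Type*} [MeasurableSpace X] {μ : Measure X}
    [IsProbabilityMeasure μ] [NormedAddCommGroup E] {p : ℝ≥0∞} [hp : Fact (1 ≤ p)] (f : Lp E p μ) :
    ∫ w, ‖f w‖ ∂μ ≤ ‖f‖ := by
  rw [integral_norm_eq_lintegral_enorm (Lp.aestronglyMeasurable f),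
    ← eLpNorm_one_eq_lintegral_enorm, Lp.norm_def]
  exact ENNReal.toReal_mono (Lp.eLpNorm_ne_top f)
    (eLpNorm_le_eLpNorm_of_exponent_le hp.out (Lp.aestronglyMeasurable f))

section FourierCoefficients

variable {p : ℝ≥0∞} [Fact (1 ≤ p)]

theorem norm_fourierCoeff_le (f : Lp ℂ p torusMeasure) (α : ℕ →₀ ℤ) :
    ‖fourierCoeff f α‖ ≤ ‖f‖ := by
  refine (norm_integral_le_integral_norm _).trans ?_
  simpa only [norm_mul, Circle.norm_coe, mul_one] using integral_norm_le_norm_Lp f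

/-- The Fourier coefficient of index `α` as a continuous linear functional on `L_p`. -/
def fourierCLM (p : ℝ≥0∞) [Fact (1 ≤ p)] (α : ℕ →₀ ℤ) : Lp ℂ p torusMeasure →L[ℂ] ℂ :=
  LinearMap.mkContinuous
    { toFun := fun f => fourierCoeff f α
      map_add' := fun f g => by
        rw [fourierCoeff_congr (Lp.coeFn_add f g)]
        simp only [fourierCoeff, Pi.add_apply, add_mul]
        exact integral_add (integrable_mul_torusMonomial f _) (integrable_mul_torusMonomial g _)
      map_smul' := fun c f => by
        rw [fourierCoeff_congr (Lp.coeFn_smul c f)]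
        simp only [fourierCoeff, Pi.smul_apply, smul_eq_mul, mul_assoc, integral_const_mul,
          RingHom.id_apply] }
    1 fun f => by simpa using norm_fourierCoeff_le f α

theorem fourierCLM_apply (α : ℕ →₀ ℤ) (f : Lp ℂ p torusMeasure) :
    fourierCLM p α f = fourierCoeff f α := rfl

theorem fourierCLM_toLp (u : C(ℕ → Circle, ℂ)) (α : ℕ →₀ ℤ) :
    fourierCLM p α (ContinuousMap.toLp p torusMeasure ℂ u) = fourierCoeff u α :=
  fourierCoeff_congr (ContinuousMap.coeFn_toLp torusMeasure u) α

/-- The character `w ↦ w^α` as an element of `L_p`. -/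
def torusCharLp (p : ℝ≥0∞) [Fact (1 ≤ p)] (α : ℕ →₀ ℤ) : Lp ℂ p torusMeasure :=
  ContinuousMap.toLp p torusMeasure ℂ (torusChar α)

theorem coeFn_torusCharLp (α : ℕ →₀ ℤ) : torusCharLp p α =ᵐ[torusMeasure] torusChar α :=
  ContinuousMap.coeFn_toLp torusMeasure (torusChar α)

theorem fourierCLM_torusCharLp (α β : ℕ →₀ ℤ) :
    fourierCLM p β (torusCharLp p α) = if α = β then 1 else 0 := by
  rw [torusCharLp, fourierCLM_toLp, fourierCoeff_torusChar]

theorem translate_torusCharLp (v : ℕ → Circle) (α : ℕ →₀ ℤ) :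
    DomMulAct.mk v • torusCharLp p α = torusChar α v • torusCharLp p α := by
  refine Lp.ext ?_
  filter_upwards [DomMulAct.smul_Lp_ae_eq (DomMulAct.mk v) (torusCharLp p α),
    Lp.coeFn_smul (torusChar α v) (torusCharLp p α), coeFn_torusCharLp (p := p) α,
    (measurePreserving_mul_left torusMeasure v).quasiMeasurePreserving.ae
      (coeFn_torusCharLp (p := p) α)]
    with w h1 h2 h3 h4
  rw [h1, h2, Pi.smul_apply, h3, Equiv.symm_apply_apply, smul_eq_mul v w, h4, torusChar_apply,
    torusMonomial_mul, Circle.coe_mul, smul_eq_mul, torusChar_apply, torusChar_apply]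

section DensityOfCharacters

variable [hp : Fact (p ≠ ∞)]

theorem topologicalClosure_span_torusCharLp :
    (Submodule.span ℂ (Set.range (torusCharLp p))).topologicalClosure = ⊤ := by
  have h := (ContinuousMap.toLp_denseRange ℂ torusMeasure ℂ hp.out).topologicalClosure_map_submodule
    topologicalClosure_span_torusChar
  rwa [Submodule.map_span, ← Set.range_comp] at h

theorem clm_ext_torusCharLp {F : Type*} [NormedAddCommGroup F] [NormedSpace ℂ F]
    {S T : Lp ℂ p torusMeasure →L[ℂ] F} (h : ∀ α, S (torusCharLp p α) = T (torusCharLp p α)) :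
    S = T :=
  ContinuousLinearMap.ext_on
    (Submodule.dense_iff_topologicalClosure_eq_top.2 topologicalClosure_span_torusCharLp)
    (by rintro _ ⟨α, rfl⟩; exact h α)

theorem translateIntegral_torusCharLp (b : C(ℕ → Circle, ℂ)) (ν : Measure (ℕ → Circle))
    [IsProbabilityMeasure ν] (α : ℕ →₀ ℤ) :
    translateIntegral b ν (torusCharLp p α) =
      (∫ v, b v * torusChar α v ∂ν) • torusCharLp p α := by
  simp only [translateIntegral_apply, translate_torusCharLp, smul_smul, integral_smul_const]

theorem fourierCLM_translateIntegral (b : C(ℕ → Circle, ℂ)) (ν : Measure (ℕ → Circle))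
    [IsProbabilityMeasure ν] (f : Lp ℂ p torusMeasure) (α : ℕ →₀ ℤ) :
    fourierCLM p α (translateIntegral b ν f) =
      (∫ v, b v * torusChar α v ∂ν) * fourierCLM p α f := by
  suffices h : (fourierCLM p α).comp (translateIntegral b ν) =
      (∫ v, b v * torusChar α v ∂ν) • fourierCLM p α from congrArg (· f) h
  refine clm_ext_torusCharLp fun β => ?_
  simp only [ContinuousLinearMap.comp_apply, translateIntegral_torusCharLp, map_smul,
    smul_apply, fourierCLM_torusCharLp]
  split_ifs with h
  · rw [h]
  · simp

theorem translateIntegral_torusChar_neg (α : ℕ →₀ ℤ) (f : Lp ℂ p torusMeasure) :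
    translateIntegral (torusChar (-α)) torusMeasure f = fourierCLM p α f • torusCharLp p α := by
  suffices h : translateIntegral (torusChar (-α)) torusMeasure =
      (fourierCLM p α).smulRight (torusCharLp p α) from congrArg (· f) h
  refine clm_ext_torusCharLp fun β => ?_
  have hint : ∫ v, torusChar (-α) v * torusChar β v ∂torusMeasure = fourierCoeff (torusChar β) α :=
    integral_congr_ae (.of_forall fun v => mul_comm _ _)
  rw [translateIntegral_torusCharLp, hint, ContinuousLinearMap.smulRight_apply,
    fourierCLM_torusCharLp, fourierCoeff_torusChar]
  split_ifs with h
  · rw [h]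
  · simp only [zero_smul]

theorem eq_zero_of_forall_fourierCoeff_eq_zero {F : C(ℕ → Circle, ℂ)}
    (hF : ∀ α, fourierCoeff F α = 0) : F = 0 := by
  have : Fact ((2 : ℝ≥0∞) ≠ ∞) := ⟨ENNReal.ofNat_ne_top⟩
  refine ContinuousMap.toLp_injective (p := 2) (𝕜 := ℂ) torusMeasure ?_
  rw [map_zero, ← Submodule.mem_bot ℂ,
    ← Submodule.topologicalClosure_eq_top_iff.1 (topologicalClosure_span_torusCharLp (p := 2)),
    Submodule.mem_orthogonal]
  refine fun q hq => Submodule.span_induction ?_ (inner_zero_left _)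
    (fun _ _ _ _ h1 h2 => by rw [inner_add_left, h1, h2, add_zero])
    (fun _ _ _ h => by rw [inner_smul_left, h, mul_zero]) hq
  rintro _ ⟨α, rfl⟩
  rw [torusCharLp, ContinuousMap.inner_toLp, ← hF α]
  refine integral_congr_ae (.of_forall fun w => ?_)
  simp only [torusChar_apply, torusMonomial_neg, Circle.coe_inv_eq_conj]

theorem mem_topologicalClosure_of_forall_dual {E : Type*} [NormedAddCommGroup E] [NormedSpace ℂ E]
    {S : Submodule ℂ E} {x : E} (h : ∀ ℓ : E →L[ℂ] ℂ, (∀ y ∈ S, ℓ y = 0) → ℓ x = 0) :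
    x ∈ S.topologicalClosure := by
  by_contra hx
  have hclosed : IsClosed (S.topologicalClosure : Set E) := S.isClosed_topologicalClosure
  have hker : ∀ y, S.topologicalClosure.mkQL y = 0 ↔ y ∈ S.topologicalClosure :=
    fun y => Submodule.Quotient.mk_eq_zero _
  have hne : S.topologicalClosure.mkQL x ≠ 0 := mt (hker x).1 hx
  obtain ⟨ℓ, -, hℓ⟩ := exists_dual_vector ℂ _ (norm_ne_zero_iff.2 hne)
  have h0 : ℓ (S.topologicalClosure.mkQL x) = 0 :=
    h (ℓ.comp S.topologicalClosure.mkQL) fun y hy => by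
      rw [ContinuousLinearMap.comp_apply, (hker y).2 (S.le_topologicalClosure hy), map_zero]
  exact hne (norm_eq_zero.1 (Complex.ofReal_eq_zero.1 (hℓ.symm.trans h0)))

theorem mem_topologicalClosure_span_spectrum (f : Lp ℂ p torusMeasure) :
    f ∈ (Submodule.span ℂ (torusCharLp p '' {α | fourierCoeff f α ≠ 0})).topologicalClosure := by
  refine mem_topologicalClosure_of_forall_dual fun ℓ hℓ => ?_
  let F : C(ℕ → Circle, ℂ) :=
    ⟨fun v => ℓ (DomMulAct.mk v • f), ℓ.continuous.comp (continuous_translate f)⟩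
  have hF : F = 0 := eq_zero_of_forall_fourierCoeff_eq_zero fun α => by
    have h1 : fourierCoeff F α = ℓ (translateIntegral (torusChar (-α)) torusMeasure f) := by
      rw [translateIntegral_apply,
        ← ℓ.integral_comp_comm (integrable_smul_translate _ torusMeasure f)]
      simp only [map_smul, smul_eq_mul, fourierCoeff, mul_comm (F _)]
      rfl
    rw [h1, translateIntegral_torusChar_neg, map_smul, smul_eq_mul, fourierCLM_apply]
    by_cases hα : fourierCoeff f α = 0
    · rw [hα, zero_mul]
    · rw [hℓ _ (Submodule.subset_span ⟨α, hα, rfl⟩), mul_zero]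
  simpa [F] using DFunLike.congr_fun hF 1

theorem lp_ext_fourierCoeff {f g : Lp ℂ p torusMeasure}
    (h : ∀ α, fourierCoeff f α = fourierCoeff g α) : f = g := by
  have hspec : {α | fourierCoeff (f - g : Lp ℂ p torusMeasure) α ≠ 0} = ∅ := by
    simp only [← fourierCLM_apply] at h
    simp only [← fourierCLM_apply, map_sub, h, sub_self, ne_eq, not_true, Set.ofPred_false]
  have hmem := mem_topologicalClosure_span_spectrum (f - g)
  rw [hspec, Set.image_empty, Submodule.span_empty,
    IsClosed.submodule_topologicalClosure_eq isClosed_singleton, Submodule.mem_bot] at hmem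
  exact sub_eq_zero.1 hmem

theorem exists_natIndex_eq {α : ℕ →₀ ℤ} (hα : ∀ i, 0 ≤ α i) : ∃ β, natIndex β = α :=
  ⟨α.mapRange Int.toNat rfl, Finsupp.ext fun i => by simpa [natIndex] using hα i⟩

theorem hpTorus_le_topologicalClosure_span : HpTorus p ≤
    (Submodule.span ℂ (Set.range fun α => torusCharLp p (natIndex α))).topologicalClosure := by
  refine fun f hf => Submodule.topologicalClosure_mono (Submodule.span_mono ?_)
    (mem_topologicalClosure_span_spectrum f)
  rintro _ ⟨α, hα, rfl⟩
  obtain ⟨β, rfl⟩ := exists_natIndex_eq fun i => not_lt.1 fun hi => hα (hf α ⟨i, hi⟩)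
  exact ⟨β, rfl⟩

end DensityOfCharacters

end FourierCoefficients

/-! ### Poisson measures -/

theorem integral_mul_circleExp {F : ℂ → ℂ} (hF : DiffContOnCl ℂ F (Metric.ball 0 1)) (v : Circle) :
    ∫ t in Set.Ioc 0 (2 * Real.pi), F (v * Circle.exp t) = (2 * Real.pi) • F 0 := by
  have hd : DiffContOnCl ℂ (fun z => F (v * z)) (Metric.ball 0 |1|) := by
    refine hF.comp (g := fun z => (v : ℂ) * z)
      (Differentiable.diffContOnCl (by fun_prop)) fun z hz => ?_
    simpa only [Metric.mem_ball, dist_zero_right, norm_mul, Circle.norm_coe, one_mul, abs_one]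
      using hz
  have h := hd.circleAverage
  rw [Real.circleAverage_def, intervalIntegral.integral_of_le Real.two_pi_pos.le, mul_zero] at h
  rw [← h, smul_inv_smul₀ Real.two_pi_pos.ne']
  simp only [circleMap_zero, Complex.ofReal_one, one_mul, Circle.coe_exp]

theorem integral_circle_eq {F : ℂ → ℂ} (hF : DiffContOnCl ℂ F (Metric.ball 0 1)) :
    ∫ v : Circle, F v ∂circleMeasure = F 0 := by
  have hcont : ContinuousOn F (Metric.closedBall 0 1) := by
    simpa only [closure_ball _ one_ne_zero] using hF.continuousOn
  obtain ⟨C, hC⟩ := (isCompact_closedBall (0 : ℂ) 1).exists_bound_of_continuousOn hcont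
  have hmem : ∀ v c : Circle, (v : ℂ) * c ∈ Metric.closedBall (0 : ℂ) 1 := fun v c => by
    simp [Circle.norm_coe]
  let μ : Measure ℝ := volume.restrict (Set.Ioc 0 (2 * Real.pi))
  have hint : Integrable (Function.uncurry fun (v : Circle) (t : ℝ) => F (v * Circle.exp t))
      (circleMeasure.prod μ) :=
    Integrable.of_bound
      (hcont.comp_continuous (by fun_prop) fun _ => hmem _ _).aestronglyMeasurable C
      (.of_forall fun q => hC _ (hmem _ _))
  have hinv : ∀ t : ℝ, ∫ v : Circle, F (v * Circle.exp t) ∂circleMeasure =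
      ∫ v : Circle, F v ∂circleMeasure := fun t =>
    integral_mul_right_eq_self (μ := circleMeasure) (fun v : Circle => F v) (Circle.exp t)
  have hswap := integral_integral_swap hint
  simp only [μ, integral_mul_circleExp hF, hinv, integral_const, probReal_univ, one_smul] at hswap
  have hμ : (volume.restrict (Set.Ioc 0 (2 * Real.pi))).real Set.univ = 2 * Real.pi := by
    simp [Measure.real, Real.pi_pos.le]
  rw [hμ] at hswap
  exact (smul_right_injective ℂ Real.two_pi_pos.ne' hswap).symm

theorem one_add_mul_ne_zero (ρ : Set.Ico (0 : ℝ) 1) {t : ℂ} (ht : ‖t‖ ≤ 1) :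
    1 + (ρ : ℝ) * t ≠ 0 := fun h => by
  have hnorm : (ρ : ℝ) * ‖t‖ = 1 := by
    rw [← Real.norm_of_nonneg ρ.2.1, ← Complex.norm_real, ← norm_mul,
      eq_neg_of_add_eq_zero_right h, norm_neg, norm_one]
  exact ((mul_le_of_le_one_right ρ.2.1 ht).trans_lt ρ.2.2).ne hnorm

theorem norm_sq_one_add_mul_sub_norm_sq_add (ρ : ℝ) (t : ℂ) :
    ‖1 + ρ * t‖ ^ 2 - ‖t + ρ‖ ^ 2 = (1 - ρ ^ 2) * (1 - ‖t‖ ^ 2) := by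
  simp only [← Complex.normSq_eq_norm_sq, Complex.normSq_apply, Complex.add_re, Complex.add_im,
    Complex.mul_re, Complex.mul_im, Complex.ofReal_re, Complex.ofReal_im, Complex.one_re,
    Complex.one_im]
  ring

theorem norm_add_eq_norm_one_add_mul (ρ : ℝ) {t : ℂ} (ht : ‖t‖ = 1) : ‖t + ρ‖ = ‖1 + ρ * t‖ := by
  have h := norm_sq_one_add_mul_sub_norm_sq_add ρ t
  rw [ht, one_pow, sub_self, mul_zero, sub_eq_zero] at h
  exact ((sq_eq_sq₀ (norm_nonneg _) (norm_nonneg _)).1 h).symm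

theorem norm_add_lt_norm_one_add_mul (ρ : Set.Ico (0 : ℝ) 1) {t : ℂ} (ht : ‖t‖ < 1) :
    ‖t + (ρ : ℝ)‖ < ‖1 + (ρ : ℝ) * t‖ := by
  refine lt_of_pow_lt_pow_left₀ 2 (norm_nonneg _) (sub_pos.1 ?_)
  rw [norm_sq_one_add_mul_sub_norm_sq_add]
  exact mul_pos (sub_pos.2 (pow_lt_one₀ ρ.2.1 ρ.2.2 two_ne_zero))
    (sub_pos.2 (pow_lt_one₀ (norm_nonneg t) ht two_ne_zero))

/-- The Möbius automorphism `v ↦ (v + ρ) / (1 + ρ v)` of the disc, restricted to the circle. -/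
def circleBlaschke (ρ : Set.Ico (0 : ℝ) 1) (v : Circle) : Circle :=
  ⟨(v + (ρ : ℝ)) / (1 + (ρ : ℝ) * v), mem_sphere_zero_iff_norm.2 <| by
    rw [norm_div, norm_add_eq_norm_one_add_mul _ (Circle.norm_coe v), div_self]
    exact norm_ne_zero_iff.2 (one_add_mul_ne_zero ρ (Circle.norm_coe v).le)⟩

theorem continuous_circleBlaschke (ρ : Set.Ico (0 : ℝ) 1) : Continuous (circleBlaschke ρ) :=
  Continuous.subtype_mk (Continuous.div (by fun_prop) (by fun_prop) fun v =>
    one_add_mul_ne_zero ρ (Circle.norm_coe v).le) _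

/-- The probability measure on the circle whose density is the Poisson kernel at `ρ`, obtained as
the image of the Haar measure under the automorphism of the disc that maps `0` to `ρ`. -/
def poissonMeasure (ρ : Set.Ico (0 : ℝ) 1) : Measure Circle :=
  circleMeasure.map (circleBlaschke ρ)

instance instIsProbabilityMeasurePoisson (ρ : Set.Ico (0 : ℝ) 1) :
    IsProbabilityMeasure (poissonMeasure ρ) :=
  Measure.isProbabilityMeasure_map (continuous_circleBlaschke ρ).aemeasurable

theorem integral_poissonMeasure_eq {F : ℂ → ℂ} (hF : DiffContOnCl ℂ F (Metric.ball 0 1))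
    (ρ : Set.Ico (0 : ℝ) 1) : ∫ v : Circle, F v ∂(poissonMeasure ρ) = F (ρ : ℝ) := by
  let B : ℂ → ℂ := fun t => (t + (ρ : ℝ)) / (1 + (ρ : ℝ) * t)
  have hB : DiffContOnCl ℂ B (Metric.ball 0 1) := by
    refine DifferentiableOn.diffContOnCl ?_
    rw [closure_ball _ one_ne_zero]
    exact DifferentiableOn.div (by fun_prop) (by fun_prop) fun t ht =>
      one_add_mul_ne_zero ρ (mem_closedBall_zero_iff.1 ht)
  have hmaps : Set.MapsTo B (Metric.ball 0 1) (Metric.ball 0 1) := fun t ht => by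
    rw [mem_ball_zero_iff] at ht ⊢
    rw [norm_div, div_lt_one (norm_pos_iff.2 (one_add_mul_ne_zero ρ ht.le))]
    exact norm_add_lt_norm_one_add_mul ρ ht
  have hcont : Continuous fun v : Circle => F v := by
    refine hF.continuousOn.comp_continuous (by fun_prop) fun v => ?_
    simp [closure_ball, Circle.norm_coe]
  rw [poissonMeasure, integral_map (continuous_circleBlaschke ρ).aemeasurable
    hcont.aestronglyMeasurable]
  refine (integral_circle_eq (hF.comp hB hmaps)).trans ?_
  simp [B]

theorem integral_zpow_poissonMeasure (ρ : Set.Ico (0 : ℝ) 1) (k : ℤ) :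
    ∫ v : Circle, (v : ℂ) ^ k ∂(poissonMeasure ρ) = (ρ : ℝ) ^ k.natAbs := by
  have hpow : ∀ n : ℕ, ∫ v : Circle, (v : ℂ) ^ n ∂(poissonMeasure ρ) = (ρ : ℝ) ^ n := fun n =>
    integral_poissonMeasure_eq (F := (· ^ n)) (Differentiable.diffContOnCl (by fun_prop)) ρ
  obtain ⟨n, rfl | rfl⟩ := k.eq_nat_or_neg
  · simpa using hpow n
  · have hconj : ∀ v : Circle, (v : ℂ) ^ (-(n : ℤ)) = starRingEnd ℂ ((v : ℂ) ^ n) := fun v => by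
      rw [map_pow, ← Circle.coe_inv_eq_conj, Circle.coe_inv, zpow_neg, zpow_natCast, inv_pow]
    simp only [hconj]
    rw [integral_conj, hpow, map_pow, Complex.conj_ofReal, Int.natAbs_neg,
      Int.natAbs_natCast]

/-- The product of the Poisson measures at the points `x i`. -/
def torusPoisson (x : ℕ → Set.Ico (0 : ℝ) 1) : Measure (ℕ → Circle) :=
  Measure.infinitePi fun i => poissonMeasure (x i)

instance instIsProbabilityMeasureTorusPoisson (x : ℕ → Set.Ico (0 : ℝ) 1) :
    IsProbabilityMeasure (torusPoisson x) :=
  inferInstanceAs (IsProbabilityMeasure (Measure.infinitePi _))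

/-- The factor `∏ x_i ^ |α_i|` by which convolution with `torusPoisson x` multiplies the Fourier
coefficient of index `α`. -/
def poissonMultiplier (x : ℕ → Set.Ico (0 : ℝ) 1) (α : ℕ →₀ ℤ) : ℂ :=
  ∏ i ∈ α.support, ((x i : ℝ) : ℂ) ^ (α i).natAbs

theorem integral_torusChar_torusPoisson (x : ℕ → Set.Ico (0 : ℝ) 1) (α : ℕ →₀ ℤ) :
    ∫ v, torusChar α v ∂(torusPoisson x) = poissonMultiplier x α := by
  simp only [torusPoisson, integral_torusChar_infinitePi, integral_zpow_poissonMeasure,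
    poissonMultiplier]

open Filter Topology in
theorem tendsto_poissonMultiplier {ι : Type*} {l : Filter ι} {x : ι → ℕ → Set.Ico (0 : ℝ) 1}
    (hx : ∀ i, Tendsto (fun k => (x k i : ℝ)) l (𝓝 1)) (α : ℕ →₀ ℤ) :
    Tendsto (fun k => poissonMultiplier (x k) α) l (𝓝 1) := by
  have hx' : ∀ i, Tendsto (fun k => ((x k i : ℝ) : ℂ)) l (𝓝 1) := fun i =>
    (Complex.continuous_ofReal.tendsto 1).comp (hx i)
  simpa [poissonMultiplier] using tendsto_finsetProd α.support fun i _ => (hx' i).pow (α i).natAbs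

/-! ### The coefficient estimate -/

section CoefficientBound

open Polynomial

theorem integral_eval_circle (P : ℂ[X]) :
    ∫ v : Circle, P.eval (v : ℂ) ∂circleMeasure = P.coeff 0 := by
  rw [integral_circle_eq P.differentiable.diffContOnCl, coeff_zero_eq_eval_zero]

theorem integral_eval_mul_conj_pow (P : ℂ[X]) (k : ℕ) :
    ∫ v : Circle, P.eval (v : ℂ) * starRingEnd ℂ v ^ k ∂circleMeasure = P.coeff k := by
  have hint : ∀ Q : ℂ[X], Integrable (fun v : Circle => Q.eval (v : ℂ) * starRingEnd ℂ v ^ k)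
      circleMeasure := fun Q => integrable_of_continuous (by fun_prop)
  induction P using Polynomial.induction_on' with
  | add P Q hP hQ =>
    simp only [eval_add, add_mul, coeff_add, ← hP, ← hQ]
    exact integral_add (hint P) (hint Q)
  | monomial n a =>
    have hzpow : ∀ v : Circle, (v : ℂ) ^ n * starRingEnd ℂ v ^ k = (v : ℂ) ^ ((n : ℤ) - k) :=
      fun v => by
        rw [zpow_sub₀ v.coe_ne_zero, zpow_natCast, zpow_natCast, ← Circle.coe_inv_eq_conj,
          Circle.coe_inv, inv_pow, div_eq_mul_inv]
    simp only [eval_monomial, mul_assoc, hzpow, integral_const_mul, coeff_monomial]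
    split_ifs with h
    · simp [h]
    · rw [integral_zpow_circle (by lia), mul_zero]

theorem norm_one_add_conj_sub_le {t : ℂ} {c : ℝ} (ht : ‖t‖ ≤ c) :
    ‖1 + starRingEnd ℂ t - t‖ ≤ Real.exp (2 * c ^ 2) := by
  have hsq : ‖1 + starRingEnd ℂ t - t‖ ^ 2 = 1 + 4 * t.im ^ 2 := by
    rw [← Complex.normSq_eq_norm_sq, Complex.normSq_apply]
    simp
    ring
  have him : t.im ^ 2 ≤ c ^ 2 :=
    sq_le_sq' (neg_le_of_abs_le ((Complex.abs_im_le_norm t).trans ht))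
      ((Complex.im_le_norm t).trans ht)
  refine le_of_sq_le_sq ?_ (Real.exp_pos _).le
  calc ‖1 + starRingEnd ℂ t - t‖ ^ 2 ≤ 4 * c ^ 2 + 1 := by linarith
    _ ≤ Real.exp (4 * c ^ 2) := Real.add_one_le_exp _
    _ = Real.exp (2 * c ^ 2) ^ 2 := by rw [← Real.exp_nat_mul]; ring_nf

theorem sum_pow_erase_zero_le {ρ : ℝ} (h0 : 0 ≤ ρ) (h1 : ρ < 1) (S : Finset ℕ) :
    ∑ k ∈ S.erase 0, ρ ^ k ≤ ρ / (1 - ρ) := by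
  have h := (summable_geometric_of_lt_one h0 h1).sum_le_tsum (insert 0 (S.erase 0))
    fun k _ => pow_nonneg h0 k
  rw [Finset.sum_insert (Finset.notMem_erase 0 S), tsum_geometric_of_lt_one h0 h1] at h
  have h2 : ρ / (1 - ρ) = (1 - ρ)⁻¹ - 1 := by
    have : 1 - ρ ≠ 0 := by linarith
    field_simp
    ring
  linarith

/-- The constant of the one-variable estimate: being `1 + O(ρ²)` it has convergent infinite
products over square summable sequences of radii. -/
def coeffConst (ρ : ℝ) : ℝ := Real.exp (2 * (ρ / (1 - ρ)) ^ 2)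

theorem integral_eval_mul_conj_eval_sum_monomial (P : ℂ[X]) (S : Finset ℕ) (a : ℕ → ℂ) :
    ∫ v : Circle, P.eval (v : ℂ) *
        starRingEnd ℂ ((∑ k ∈ S, monomial k (a k)).eval (v : ℂ)) ∂circleMeasure =
      ∑ k ∈ S, starRingEnd ℂ (a k) * P.coeff k := by
  have h : ∀ v : Circle, P.eval (v : ℂ) *
      starRingEnd ℂ ((∑ k ∈ S, monomial k (a k)).eval (v : ℂ)) =
        ∑ k ∈ S, starRingEnd ℂ (a k) * (P.eval (v : ℂ) * starRingEnd ℂ v ^ k) := fun v => by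
    simp only [eval_finsetSum, eval_monomial, map_sum, map_mul, map_pow, Finset.mul_sum,
      mul_left_comm]
  simp only [h]
  rw [integral_finsetSum _ fun k _ => integrable_of_continuous (by fun_prop)]
  simp only [integral_const_mul, integral_eval_mul_conj_pow]

theorem integral_eval_mul_one_add_conj_sub (P : ℂ[X]) {S : Finset ℕ} (hS : 0 ∉ S) (a : ℕ → ℂ) :
    ∫ v : Circle, P.eval (v : ℂ) *
        (1 + starRingEnd ℂ ((∑ k ∈ S, monomial k (a k)).eval (v : ℂ)) -
          (∑ k ∈ S, monomial k (a k)).eval (v : ℂ)) ∂circleMeasure =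
      P.coeff 0 + ∑ k ∈ S, starRingEnd ℂ (a k) * P.coeff k := by
  set Q : ℂ[X] := ∑ k ∈ S, monomial k (a k) with hQ
  have hPQ : ∫ v : Circle, (P * Q).eval (v : ℂ) ∂circleMeasure = 0 := by
    rw [integral_eval_circle, mul_coeff_zero, hQ, finsetSum_coeff, Finset.sum_eq_zero, mul_zero]
    exact fun k hk => coeff_monomial_of_ne _ (ne_of_mem_of_not_mem hk hS).symm
  calc ∫ v : Circle, P.eval (v : ℂ) *
        (1 + starRingEnd ℂ (Q.eval (v : ℂ)) - Q.eval (v : ℂ)) ∂circleMeasure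
      = ∫ v : Circle, P.eval (v : ℂ) + P.eval (v : ℂ) * starRingEnd ℂ (Q.eval (v : ℂ)) -
          (P * Q).eval (v : ℂ) ∂circleMeasure := by simp only [mul_sub, mul_add, mul_one, eval_mul]
    _ = ∫ v : Circle, P.eval (v : ℂ) ∂circleMeasure +
          ∫ v : Circle, P.eval (v : ℂ) * starRingEnd ℂ (Q.eval (v : ℂ)) ∂circleMeasure -
          ∫ v : Circle, (P * Q).eval (v : ℂ) ∂circleMeasure := by
        rw [integral_sub, integral_add] <;>
          exact integrable_of_continuous (by fun_prop)
    _ = P.coeff 0 + ∑ k ∈ S, starRingEnd ℂ (a k) * P.coeff k := by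
        rw [hPQ, sub_zero, integral_eval_circle, hQ, integral_eval_mul_conj_eval_sum_monomial]

-- The coefficients are paired with the test function `c₀ (1 + conj g - g)`, where `g` is analytic
-- with `g(0) = 0`: only `conj g` sees the coefficients of positive index, while subtracting `g`
-- makes the perturbation purely imaginary, so that the sup norm is `1 + O(ρ²)` and not `1 + O(ρ)`.
theorem norm_coeff_zero_add_sum_le {ρ : ℝ} (h0 : 0 ≤ ρ) (h1 : ρ < 1) (P : ℂ[X]) (S : Finset ℕ) :
    ‖P.coeff 0‖ + ∑ k ∈ S.erase 0, ρ ^ k * ‖P.coeff k‖ ≤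
      coeffConst ρ * ∫ v : Circle, ‖P.eval (v : ℂ)‖ ∂circleMeasure := by
  choose c hc hcP using fun k => Complex.exists_norm_eq_mul_self (P.coeff k)
  have hc0 : c 0 * starRingEnd ℂ (c 0) = 1 := by
    rw [Complex.mul_conj, Complex.normSq_eq_norm_sq, hc, one_pow, Complex.ofReal_one]
  let g : ℂ[X] := ∑ k ∈ S.erase 0, monomial k (ρ ^ k * (c 0 * starRingEnd ℂ (c k)))
  have hgv : ∀ v : Circle, ‖g.eval (v : ℂ)‖ ≤ ρ / (1 - ρ) := fun v => by
    simp only [g, eval_finsetSum, eval_monomial]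
    refine (norm_sum_le_of_le _ fun k _ => ?_).trans (sum_pow_erase_zero_le h0 h1 S)
    simp [hc, Circle.norm_coe, abs_of_nonneg h0]
  have hpair : ((‖P.coeff 0‖ + ∑ k ∈ S.erase 0, ρ ^ k * ‖P.coeff k‖ : ℝ) : ℂ) =
      c 0 * ∫ v : Circle, P.eval (v : ℂ) *
        (1 + starRingEnd ℂ (g.eval (v : ℂ)) - g.eval (v : ℂ)) ∂circleMeasure := by
    rw [integral_eval_mul_one_add_conj_sub P (Finset.notMem_erase 0 S), mul_add, ← hcP,
      Finset.mul_sum]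
    push_cast
    refine congrArg _ (Finset.sum_congr rfl fun k _ => ?_)
    rw [map_mul, map_mul, map_pow, Complex.conj_ofReal, Complex.conj_conj, hcP]
    linear_combination (-(ρ : ℂ) ^ k * (c k * P.coeff k)) * hc0
  rw [← Real.norm_of_nonneg (by positivity : 0 ≤ ‖P.coeff 0‖ + ∑ k ∈ S.erase 0, _),
    ← Complex.norm_real, hpair, norm_mul, hc, one_mul, ← integral_const_mul]
  refine norm_integral_le_of_norm_le (integrable_of_continuous (by fun_prop)) ?_
  refine .of_forall fun v => ?_
  rw [norm_mul, mul_comm]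
  gcongr
  exact norm_one_add_conj_sub_le (hgv v)

theorem sum_pow_mul_norm_coeff_le {ρ : ℝ} (h0 : 0 ≤ ρ) (h1 : ρ < 1) (P : ℂ[X]) (S : Finset ℕ) :
    ∑ k ∈ S, ρ ^ k * ‖P.coeff k‖ ≤
      coeffConst ρ * ∫ v : Circle, ‖P.eval (v : ℂ)‖ ∂circleMeasure := by
  refine le_trans ?_ (norm_coeff_zero_add_sum_le h0 h1 P S)
  refine (Finset.sum_le_sum_of_subset_of_nonneg (Finset.insert_erase_subset 0 S)
    fun k _ _ => by positivity).trans_eq ?_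
  rw [Finset.sum_insert (Finset.notMem_erase 0 S), pow_zero, one_mul]

end CoefficientBound

section AnalyticPolynomials

open Polynomial

/-- The analytic trigonometric polynomial `∑_{α ∈ F} a_α w^α` on `𝕋^∞`. -/
def analyticPoly (F : Finset (ℕ →₀ ℕ)) (a : (ℕ →₀ ℕ) → ℂ) : C(ℕ → Circle, ℂ) :=
  ∑ α ∈ F, a α • torusChar (natIndex α)

theorem analyticPoly_apply (F : Finset (ℕ →₀ ℕ)) (a : (ℕ →₀ ℕ) → ℂ) (w : ℕ → Circle) :
    analyticPoly F a w = ∑ α ∈ F, a α * torusChar (natIndex α) w := by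
  simp only [analyticPoly, ContinuousMap.sum_apply, ContinuousMap.smul_apply, smul_eq_mul]

theorem torusChar_mulSingle (α : ℕ →₀ ℤ) (i : ℕ) (v : Circle) :
    torusChar α (Pi.mulSingle i v) = (v : ℂ) ^ α i := by
  rw [torusChar_eq_prod, Finset.prod_eq_single i, Pi.mulSingle_eq_same]
  · intro j _ hj
    rw [Pi.mulSingle_eq_of_ne hj, Circle.coe_one, one_zpow]
  · intro hi
    rw [Finsupp.notMem_support_iff.1 hi, zpow_zero]

theorem torusChar_mul_mulSingle (α : ℕ →₀ ℤ) (w : ℕ → Circle) (i : ℕ) (v : Circle) :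
    torusChar α (w * Pi.mulSingle i v) = torusChar α w * (v : ℂ) ^ α i := by
  rw [← torusChar_mulSingle]
  simp only [torusChar_apply, torusMonomial_mul, Circle.coe_mul]

theorem integrable_comp_mul_mulSingle {u : (ℕ → Circle) → ℝ} (hu : Continuous u) (i : ℕ) :
    Integrable (Function.uncurry fun (w : ℕ → Circle) (v : Circle) => u (w * Pi.mulSingle i v))
      (torusMeasure.prod circleMeasure) :=
  integrable_of_continuous
    (hu.comp (continuous_fst.mul ((continuous_mulSingle i).comp continuous_snd)))

theorem integral_integral_mul_mulSingle {u : (ℕ → Circle) → ℝ} (hu : Continuous u) (i : ℕ) :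
    ∫ w, ∫ v : Circle, u (w * Pi.mulSingle i v) ∂circleMeasure ∂torusMeasure =
      ∫ w, u w ∂torusMeasure := by
  rw [integral_integral_swap (integrable_comp_mul_mulSingle hu i)]
  simp only [integral_mul_right_eq_self u, integral_const, probReal_univ, one_smul]

/-- The one-variable polynomial `t ↦ ∑_{α ∈ F} a_α w^α t^{α_i}`. -/
def slicePoly (F : Finset (ℕ →₀ ℕ)) (a : (ℕ →₀ ℕ) → ℂ) (w : ℕ → Circle) (i : ℕ) : ℂ[X] :=
  ∑ α ∈ F, monomial (α i) (a α * torusChar (natIndex α) w)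

theorem eval_slicePoly (F : Finset (ℕ →₀ ℕ)) (a : (ℕ →₀ ℕ) → ℂ) (w : ℕ → Circle) (i : ℕ)
    (v : Circle) : (slicePoly F a w i).eval (v : ℂ) = analyticPoly F a (w * Pi.mulSingle i v) := by
  simp only [slicePoly, eval_finsetSum, eval_monomial, analyticPoly_apply, torusChar_mul_mulSingle,
    mul_assoc]
  rfl

theorem coeff_slicePoly (F : Finset (ℕ →₀ ℕ)) (a : (ℕ →₀ ℕ) → ℂ) (w : ℕ → Circle) (i k : ℕ) :
    (slicePoly F a w i).coeff k = analyticPoly {α ∈ F | α i = k} a w := by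
  simp only [slicePoly, finsetSum_coeff, coeff_monomial, analyticPoly_apply, Finset.sum_filter]

theorem sum_integral_fiber_le {ρ : ℝ} (h0 : 0 ≤ ρ) (h1 : ρ < 1) (F : Finset (ℕ →₀ ℕ))
    (a : (ℕ →₀ ℕ) → ℂ) (i : ℕ) (S : Finset ℕ) :
    ∑ k ∈ S, ρ ^ k * ∫ w, ‖analyticPoly {α ∈ F | α i = k} a w‖ ∂torusMeasure ≤
      coeffConst ρ * ∫ w, ‖analyticPoly F a w‖ ∂torusMeasure := by
  have hcont : ∀ G, Continuous fun w => ‖analyticPoly G a w‖ := fun G =>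
    (analyticPoly G a).continuous.norm
  have hint : ∀ k ∈ S, Integrable (fun w => ρ ^ k * ‖analyticPoly {α ∈ F | α i = k} a w‖)
      torusMeasure := fun k _ => (integrable_of_continuous (hcont _)).const_mul _
  rw [← integral_integral_mul_mulSingle (hcont F) i, ← integral_const_mul]
  simp only [← integral_const_mul (ρ ^ _)]
  rw [← integral_finsetSum S hint]
  refine integral_mono (integrable_finsetSum S hint)
    ((integrable_comp_mul_mulSingle (hcont F) i).integral_prod_left.const_mul _) fun w => ?_
  simpa only [coeff_slicePoly, eval_slicePoly] using
    sum_pow_mul_norm_coeff_le h0 h1 (slicePoly F a w i) S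

end AnalyticPolynomials

theorem sum_prod_pow_mul_norm_le {x : ℕ → ℝ} (h0 : ∀ i, 0 ≤ x i) (h1 : ∀ i, x i < 1)
    (a : (ℕ →₀ ℕ) → ℂ) (S : Finset ℕ) (F : Finset (ℕ →₀ ℕ))
    (hF : ∀ α ∈ F, ∀ β ∈ F, (∀ i ∈ S, α i = β i) → α = β) :
    ∑ α ∈ F, (∏ i ∈ S, x i ^ α i) * ‖a α‖ ≤
      (∏ i ∈ S, coeffConst (x i)) * ∫ w, ‖analyticPoly F a w‖ ∂torusMeasure := by
  induction S using Finset.induction_on generalizing F with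
  | empty =>
    rcases F.eq_empty_or_nonempty with rfl | ⟨β, hβ⟩
    · simpa using integral_nonneg fun w => norm_nonneg (analyticPoly ∅ a w)
    · obtain rfl : F = {β} := Finset.eq_singleton_iff_unique_mem.2
        ⟨hβ, fun α hα => hF α hα β hβ (by simp)⟩
      simp [analyticPoly_apply, torusChar_apply, Circle.norm_coe]
  | insert i S hi ih =>
    have hfiber : ∀ k, ∑ α ∈ F with α i = k, (∏ j ∈ insert i S, x j ^ α j) * ‖a α‖ ≤
        x i ^ k * ((∏ j ∈ S, coeffConst (x j)) *
          ∫ w, ‖analyticPoly {α ∈ F | α i = k} a w‖ ∂torusMeasure) := fun k => by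
      refine le_trans (le_of_eq ?_) (mul_le_mul_of_nonneg_left
        (ih {α ∈ F | α i = k} fun α hα β hβ hαβ => ?_) (pow_nonneg (h0 i) k))
      · rw [Finset.mul_sum]
        refine Finset.sum_congr rfl fun α hα => ?_
        rw [Finset.prod_insert hi, (Finset.mem_filter.1 hα).2, mul_assoc]
      · rw [Finset.mem_filter] at hα hβ
        exact hF α hα.1 β hβ.1 (Finset.forall_mem_insert .. |>.2 ⟨hα.2.trans hβ.2.symm, hαβ⟩)
    rw [← Finset.sum_fiberwise_of_maps_to fun α hα => Finset.mem_image_of_mem (fun α => α i) hα]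
    calc _ ≤ ∑ k ∈ F.image fun α => α i, x i ^ k * ((∏ j ∈ S, coeffConst (x j)) *
          ∫ w, ‖analyticPoly {α ∈ F | α i = k} a w‖ ∂torusMeasure) :=
        Finset.sum_le_sum fun k _ => hfiber k
      _ = (∏ j ∈ S, coeffConst (x j)) * ∑ k ∈ F.image fun α => α i,
          x i ^ k * ∫ w, ‖analyticPoly {α ∈ F | α i = k} a w‖ ∂torusMeasure := by
        simp only [Finset.mul_sum, mul_left_comm]
      _ ≤ (∏ j ∈ S, coeffConst (x j)) *
          (coeffConst (x i) * ∫ w, ‖analyticPoly F a w‖ ∂torusMeasure) :=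
        mul_le_mul_of_nonneg_left (sum_integral_fiber_le (h0 i) (h1 i) F a i _)
          (Finset.prod_nonneg fun j _ => (Real.exp_pos _).le)
      _ = _ := by rw [Finset.prod_insert hi, mul_left_comm, mul_assoc]

theorem summable_norm_sq (z : ellTwo) : Summable fun i => ‖z i‖ ^ 2 := by
  simpa using (lp.hasSum_norm (p := 2) (by simp) z).summable

theorem sum_norm_sq_le (z : ellTwo) (S : Finset ℕ) : ∑ i ∈ S, ‖z i‖ ^ 2 ≤ ‖z‖ ^ 2 := by
  simpa using lp.sum_rpow_le_norm_rpow (p := 2) (by simp) z S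

theorem exists_forall_norm_apply_le (z : polydisc) : ∃ s < 1, ∀ i, ‖(z : ellTwo) i‖ ≤ s := by
  by_cases hz : ∀ i, (z : ellTwo) i = 0
  · exact ⟨0, zero_lt_one, fun i => by rw [hz, norm_zero]⟩
  · obtain ⟨j, hj⟩ := not_forall.1 hz
    have hev : ∀ᶠ i in Filter.cocompact ℕ, ‖(z : ellTwo) i‖ ≤ ‖(z : ellTwo) j‖ := by
      rw [Filter.cocompact_eq_cofinite]
      filter_upwards [(summable_norm_sq z).tendsto_cofinite_zero.eventually
        (gt_mem_nhds (pow_pos (norm_pos_iff.2 hj) 2))] with i hi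
      exact (lt_of_pow_lt_pow_left₀ 2 (norm_nonneg _) hi).le
    obtain ⟨k, hk⟩ := continuous_of_discreteTopology.exists_forall_ge' j hev
    exact ⟨_, z.2 k, hk⟩

theorem norm_apply_le_add (y z : ellTwo) (i : ℕ) : ‖y i‖ ≤ ‖z i‖ + ‖y - z‖ :=
  (norm_le_norm_add_norm_sub' _ _).trans
    (add_le_add_right (lp.norm_apply_le_norm two_ne_zero (y - z) i) _)

theorem isOpen_polydisc : IsOpen polydisc := by
  refine Metric.isOpen_iff.2 fun z hz => ?_
  obtain ⟨s, hs, hzs⟩ := exists_forall_norm_apply_le ⟨z, hz⟩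
  refine ⟨1 - s, sub_pos.2 hs, fun y hy i => (norm_apply_le_add y z i).trans_lt ?_⟩
  rw [mem_ball_iff_norm] at hy
  linarith [hzs i]

theorem prod_coeffConst_le {z : ellTwo} {s : ℝ} (hs : s < 1) (hz : ∀ i, ‖z i‖ ≤ s)
    (S : Finset ℕ) : ∏ i ∈ S, coeffConst ‖z i‖ ≤ Real.exp (2 * (‖z‖ / (1 - s)) ^ 2) := by
  have h1 : 0 < 1 - s := sub_pos.2 hs
  simp only [coeffConst, ← Real.exp_sum, ← Finset.mul_sum]
  gcongr
  calc ∑ i ∈ S, (‖z i‖ / (1 - ‖z i‖)) ^ 2 ≤ ∑ i ∈ S, ‖z i‖ ^ 2 / (1 - s) ^ 2 := by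
        refine Finset.sum_le_sum fun i _ => ?_
        have h := hz i
        have h2 : 0 < 1 - ‖z i‖ := h1.trans_le (by gcongr)
        rw [← div_pow]
        gcongr
    _ ≤ (‖z‖ / (1 - s)) ^ 2 := by
        rw [← Finset.sum_div, div_pow]
        gcongr
        exact sum_norm_sq_le z S

theorem norm_discMonomial_eq_prod {α : ℕ →₀ ℕ} {S : Finset ℕ} (hS : α.support ⊆ S)
    (z : polydisc) : ‖discMonomial α z‖ = ∏ i ∈ S, ‖(z : ellTwo) i‖ ^ α i := by
  rw [discMonomial, α.prod_of_support_subset hS _ fun i _ => pow_zero _, norm_prod]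
  simp only [norm_pow]

theorem sum_norm_mul_discMonomial_le {z : polydisc} {s : ℝ} (hs : s < 1)
    (hz : ∀ i, ‖(z : ellTwo) i‖ ≤ s) (F : Finset (ℕ →₀ ℕ)) (a : (ℕ →₀ ℕ) → ℂ) :
    ∑ α ∈ F, ‖a α * discMonomial α z‖ ≤
      Real.exp (2 * (‖(z : ellTwo)‖ / (1 - s)) ^ 2) * ∫ w, ‖analyticPoly F a w‖ ∂torusMeasure := by
  have hsub : ∀ α ∈ F, α.support ⊆ F.sup Finsupp.support := fun α hα => Finset.le_sup hα
  have hinj : ∀ α ∈ F, ∀ β ∈ F, (∀ i ∈ F.sup Finsupp.support, α i = β i) → α = β :=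
    fun α hα β hβ h => Finsupp.ext fun i => by
      by_cases hi : i ∈ F.sup Finsupp.support
      · exact h i hi
      · rw [Finsupp.notMem_support_iff.1 fun h => hi (hsub α hα h),
          Finsupp.notMem_support_iff.1 fun h => hi (hsub β hβ h)]
  calc ∑ α ∈ F, ‖a α * discMonomial α z‖
      = ∑ α ∈ F, (∏ i ∈ F.sup Finsupp.support, ‖(z : ellTwo) i‖ ^ α i) * ‖a α‖ :=
        Finset.sum_congr rfl fun α hα => by
          rw [norm_mul, norm_discMonomial_eq_prod (hsub α hα), mul_comm]
    _ ≤ (∏ i ∈ F.sup Finsupp.support, coeffConst ‖(z : ellTwo) i‖) *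
          ∫ w, ‖analyticPoly F a w‖ ∂torusMeasure :=
        sum_prod_pow_mul_norm_le (fun i => norm_nonneg _) (fun i => z.2 i) a _ F hinj
    _ ≤ _ := mul_le_mul_of_nonneg_right (prod_coeffConst_le hs hz _)
        (integral_nonneg fun w => norm_nonneg _)

section TaylorSeries

variable {p : ℝ≥0∞} [Fact (1 ≤ p)]

/-- The coefficient `f̂(α)`, `α ∈ ℕ₀^(ℕ)`, as a functional on `H_p(𝕋^∞)`. -/
def hpCoeff (p : ℝ≥0∞) [Fact (1 ≤ p)] (α : ℕ →₀ ℕ) : HpTorus p →L[ℂ] ℂ :=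
  (fourierCLM p (natIndex α)).comp (HpTorus p).subtypeL

/-- The monomial `w^α`, `α ∈ ℕ₀^(ℕ)`, as an element of `H_p(𝕋^∞)`. -/
def hpChar (p : ℝ≥0∞) [Fact (1 ≤ p)] (α : ℕ →₀ ℕ) : HpTorus p :=
  ⟨torusCharLp p (natIndex α), fun β ⟨i, hi⟩ => by
    rw [← fourierCLM_apply, fourierCLM_torusCharLp, if_neg]
    rintro rfl
    exact hi.not_ge (Int.natCast_nonneg (α i))⟩

theorem natIndex_injective : Function.Injective natIndex :=
  Finsupp.mapRange_injective _ Nat.cast_zero Nat.cast_injective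

theorem hpCoeff_hpChar (α β : ℕ →₀ ℕ) : hpCoeff p β (hpChar p α) = if α = β then 1 else 0 := by
  refine (fourierCLM_torusCharLp (p := p) _ _).trans ?_
  simp only [natIndex_injective.eq_iff]

theorem hpCoeff_sum_hpChar (c : (ℕ →₀ ℕ) →₀ ℂ) (β : ℕ →₀ ℕ) :
    hpCoeff p β (c.sum fun α a => a • hpChar p α) = c β := by
  simp only [map_finsuppSum, map_smul, hpCoeff_hpChar, smul_eq_mul, mul_ite, mul_one, mul_zero,
    Finsupp.sum_ite_self_eq']

theorem coeFn_sum_hpChar (c : (ℕ →₀ ℕ) →₀ ℂ) :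
    ((c.sum fun α a => a • hpChar p α : HpTorus p) : Lp ℂ p torusMeasure) =ᵐ[torusMeasure]
      analyticPoly c.support c := by
  have h : ((c.sum fun α a => a • hpChar p α : HpTorus p) : Lp ℂ p torusMeasure) =
      ContinuousMap.toLp p torusMeasure ℂ (analyticPoly c.support c) := by
    simp only [analyticPoly, map_sum, map_smul, Finsupp.sum, Submodule.coe_sum]
    rfl
  rw [h]
  exact ContinuousMap.coeFn_toLp torusMeasure _

variable [Fact (p ≠ ∞)]

theorem topologicalClosure_span_hpChar :
    (Submodule.span ℂ (Set.range (hpChar p))).topologicalClosure = ⊤ := by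
  refine eq_top_iff.2 fun f _ => ?_
  have h := hpTorus_le_topologicalClosure_span f.2
  rw [← SetLike.mem_coe, Submodule.topologicalClosure_coe] at h ⊢
  rw [Topology.IsInducing.subtypeVal.closure_eq_preimage_closure_image]
  change (f : Lp ℂ p torusMeasure) ∈ closure ((HpTorus p).subtype '' _)
  rwa [← Submodule.map_coe, Submodule.map_span, ← Set.range_comp]

theorem sum_norm_hpCoeff_mul_le {z : polydisc} {s : ℝ} (hs : s < 1)
    (hz : ∀ i, ‖(z : ellTwo) i‖ ≤ s) (f : HpTorus p) (S : Finset (ℕ →₀ ℕ)) :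
    ∑ α ∈ S, ‖hpCoeff p α f * discMonomial α z‖ ≤
      Real.exp (2 * (‖(z : ellTwo)‖ / (1 - s)) ^ 2) * ‖f‖ := by
  have hclosed : IsClosed {f : HpTorus p | ∑ α ∈ S, ‖hpCoeff p α f * discMonomial α z‖ ≤
      Real.exp (2 * (‖(z : ellTwo)‖ / (1 - s)) ^ 2) * ‖f‖} :=
    isClosed_le (by fun_prop) (by fun_prop)
  refine hclosed.closure_subset_iff.2 ?_
    ((topologicalClosure_span_hpChar (p := p)).ge (Submodule.mem_top (x := f)))
  intro f hf
  obtain ⟨c, rfl⟩ := Finsupp.mem_span_range_iff_exists_finsupp.1 hf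
  simp only [Set.mem_ofPred_eq, hpCoeff_sum_hpChar]
  calc ∑ α ∈ S, ‖c α * discMonomial α z‖ ≤ ∑ α ∈ c.support, ‖c α * discMonomial α z‖ := by
        rw [← Finset.sum_filter_ne_zero]
        refine Finset.sum_le_sum_of_subset_of_nonneg (fun α hα => ?_) fun _ _ _ => norm_nonneg _
        exact Finsupp.mem_support_iff.2 fun h => (Finset.mem_filter.1 hα).2 (by simp [h])
    _ ≤ _ := sum_norm_mul_discMonomial_le hs hz _ _
    _ ≤ _ := by
        refine mul_le_mul_of_nonneg_left ?_ (Real.exp_pos _).le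
        refine le_trans (le_of_eq (integral_congr_ae ?_)) (integral_norm_le_norm_Lp _)
        exact (coeFn_sum_hpChar c).mono fun w hw => congrArg norm hw.symm

theorem exists_eventually_sum_norm_le (z : polydisc) : ∃ C, ∀ᶠ y in nhds z,
    ∀ (f : HpTorus p) S, ∑ α ∈ S, ‖hpCoeff p α f * discMonomial α y‖ ≤ C * ‖f‖ := by
  obtain ⟨s, hs, hz⟩ := exists_forall_norm_apply_le z
  refine ⟨Real.exp (2 * ((‖(z : ellTwo)‖ + (1 - s) / 2) / (1 - (1 + s) / 2)) ^ 2), ?_⟩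
  filter_upwards [Metric.ball_mem_nhds z (half_pos (sub_pos.2 hs))] with y hy f S
  have hd : ‖(y - z : ellTwo)‖ < (1 - s) / 2 := by rwa [← dist_eq_norm]
  have hyn : ‖(y : ellTwo)‖ ≤ ‖(z : ellTwo)‖ + (1 - s) / 2 :=
    (norm_le_norm_add_norm_sub' _ _).trans (by gcongr)
  have hyi : ∀ i, ‖(y : ellTwo) i‖ ≤ (1 + s) / 2 := fun i => by
    linarith [hz i, norm_apply_le_add (y : ellTwo) z i]
  have h1 : 0 < 1 - (1 + s) / 2 := by linarith
  refine (sum_norm_hpCoeff_mul_le (sub_pos.1 h1) hyi f S).trans ?_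
  gcongr

end TaylorSeries

/-! ### The map `φ` and its isometry -/

section LocallyUniformLimit

open Filter Topology

variable {E F ι : Type*} [NormedAddCommGroup E] [NormedSpace ℂ E] [NormedAddCommGroup F]
  [NormedSpace ℂ F]

theorem norm_fderiv_le_of_forall_mem_ball {f : E → F} {x : E} {R C : ℝ} (hR : 0 < R)
    (hf : DifferentiableOn ℂ f (Metric.ball x R)) (hC : ∀ y ∈ Metric.ball x R, ‖f y‖ ≤ C) :
    ‖fderiv ℂ f x‖ ≤ (C + C) / R := by
  refine Complex.norm_fderiv_le_div_of_mapsTo_ball hf (fun y hy => ?_) hR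
  rw [mem_closedBall_iff_norm]
  exact norm_sub_le_of_le (hC y hy) (hC x (Metric.mem_ball_self hR))

theorem uniformCauchySeqOn_fderiv {u : ι → E → F} {l : Filter ι} {x : E} {R : ℝ} (hR : 0 < R)
    (hu : ∀ n, DifferentiableOn ℂ (u n) (Metric.ball x (R + R)))
    (hc : UniformCauchySeqOn u l (Metric.ball x (R + R))) :
    UniformCauchySeqOn (fun n => fderiv ℂ (u n)) l (Metric.ball x R) := by
  intro V hV
  obtain ⟨ε, hε, hεV⟩ := Metric.mem_uniformity_dist.1 hV
  have hδ : 0 < ε * R / 4 := by positivity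
  filter_upwards [hc _ (Metric.dist_mem_uniformity hδ)] with m hm y hy
  have hsub : Metric.ball y R ⊆ Metric.ball x (R + R) :=
    Metric.ball_subset_ball' (by rw [Metric.mem_ball] at hy; gcongr)
  have hdiff : ∀ n, DifferentiableAt ℂ (u n) y := fun n =>
    (hu n).differentiableAt (Metric.isOpen_ball.mem_nhds (hsub (Metric.mem_ball_self hR)))
  refine hεV ?_
  rw [dist_eq_norm, ← fderiv_sub (hdiff _) (hdiff _)]
  refine (norm_fderiv_le_of_forall_mem_ball hR (((hu _).sub (hu _)).mono hsub)
    (C := ε * R / 4) fun z hz => ?_).trans_lt ?_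
  · rw [Pi.sub_apply, ← dist_eq_norm]
    exact (hm z (hsub hz)).le
  · rw [div_lt_iff₀ hR]
    linarith [mul_pos hε hR]

theorem differentiableAt_of_tendstoUniformlyOn [CompleteSpace F] {u : ι → E → F} {f : E → F}
    {l : Filter ι} [l.NeBot] {x : E} {t : Set E} (ht : t ∈ 𝓝 x)
    (hu : ∀ n, DifferentiableOn ℂ (u n) t) (h : TendstoUniformlyOn u f l t) :
    DifferentiableAt ℂ f x := by
  obtain ⟨R, hR, hRt⟩ := Metric.mem_nhds_iff.1 ht
  have hsub : Metric.ball x (R / 2 + R / 2) ⊆ t := by rwa [add_halves]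
  have hhalf : Metric.ball x (R / 2) ⊆ t :=
    (Metric.ball_subset_ball (half_le_self hR.le)).trans hRt
  have hc := uniformCauchySeqOn_fderiv (half_pos hR) (fun n => (hu n).mono hsub)
    (h.mono hsub).uniformCauchySeqOn
  have hlim : ∀ y ∈ Metric.ball x (R / 2), Tendsto (fun n => fderiv ℂ (u n) y) l
      (𝓝 (limUnder l fun n => fderiv ℂ (u n) y)) := fun y hy =>
    tendsto_nhds_limUnder (cauchy_map_iff_exists_tendsto.1 (hc.cauchy_map hy))
  have hderiv : ∀ n, ∀ y ∈ Metric.ball x (R / 2), HasFDerivAt (u n) (fderiv ℂ (u n) y) y :=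
    fun n y hy => (((hu n).mono hhalf).differentiableAt
      (Metric.isOpen_ball.mem_nhds hy)).hasFDerivAt
  exact (hasFDerivAt_of_tendstoUniformlyOn Metric.isOpen_ball
    (hc.tendstoUniformlyOn_of_tendsto hlim) hderiv (fun y hy => h.tendsto_at (hhalf hy))
    (Metric.mem_ball_self (half_pos hR))).differentiableAt

theorem isHolomorphic_of_tendstoUniformlyOn {u : ι → polydisc → ℂ} {g : polydisc → ℂ}
    {l : Filter ι} [l.NeBot] (hu : ∀ n, IsHolomorphic (u n))
    (h : ∀ z, ∃ t ∈ 𝓝 z, TendstoUniformlyOn u g l t) : IsHolomorphic g := by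
  choose U hU hUu using hu
  have hval : ∀ z : polydisc, Function.extend Subtype.val g 0 (z : ellTwo) = g z := fun z =>
    Subtype.val_injective.extend_apply g 0 z
  refine ⟨Function.extend Subtype.val g 0, fun z hz => ?_, hval⟩
  obtain ⟨t, ht, htu⟩ := h ⟨z, hz⟩
  refine (differentiableAt_of_tendstoUniformlyOn (u := U) (l := l)
    (isOpen_polydisc.isOpenEmbedding_subtypeVal.image_mem_nhds.2 ht) (fun n => ?_)
    fun V hV => ?_).differentiableWithinAt
  · exact (hU n).mono (Subtype.coe_image_subset _ _)
  · filter_upwards [htu V hV] with n hn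
    rintro _ ⟨y, hy, rfl⟩
    rw [hval, hUu]
    exact hn y hy

end LocallyUniformLimit

section TaylorSeries

variable {p : ℝ≥0∞} [Fact (1 ≤ p)] [Fact (p ≠ ∞)]

theorem summable_norm_hpCoeff_mul (f : HpTorus p) (z : polydisc) :
    Summable fun α => ‖hpCoeff p α f * discMonomial α z‖ := by
  obtain ⟨C, hC⟩ := exists_eventually_sum_norm_le (p := p) z
  exact summable_of_sum_le (fun _ => norm_nonneg _) (hC.self_of_nhds f)

/-- The map `φ`, sending `f ∈ H_p(𝕋^∞)` to the function `z ↦ ∑ f̂(α) z^α` on `𝔻^∞ ∩ ℓ₂`. -/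
def taylorSum : HpTorus p →ₗ[ℂ] polydisc → ℂ where
  toFun f z := ∑' α, hpCoeff p α f * discMonomial α z
  map_add' f g := funext fun z => by
    simp only [map_add, add_mul, Pi.add_apply]
    exact (summable_norm_hpCoeff_mul f z).of_norm.tsum_add (summable_norm_hpCoeff_mul g z).of_norm
  map_smul' c f := funext fun z => by
    simp only [map_smul, smul_eq_mul, mul_assoc, tsum_mul_left, RingHom.id_apply, Pi.smul_apply]

theorem hasSum_taylorSum (f : HpTorus p) (z : polydisc) :
    HasSum (fun α => hpCoeff p α f * discMonomial α z) (taylorSum f z) :=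
  (summable_norm_hpCoeff_mul f z).of_norm.hasSum

theorem taylorSum_hpChar (α : ℕ →₀ ℕ) : taylorSum (hpChar p α) = discMonomial α := by
  funext z
  refine (hasSum_taylorSum _ z).unique ?_
  simp only [hpCoeff_hpChar, ite_mul, one_mul, zero_mul, eq_comm (a := α)]
  convert hasSum_ite_eq α (discMonomial α z) using 3 with β h
  rw [h]

theorem exists_eventually_norm_taylorSum_le (z : polydisc) : ∃ C, ∀ᶠ y in nhds z,
    ∀ f : HpTorus p, ‖taylorSum f y‖ ≤ C * ‖f‖ := by
  obtain ⟨C, hC⟩ := exists_eventually_sum_norm_le (p := p) z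
  refine ⟨C, hC.mono fun y hy f => ?_⟩
  exact (norm_tsum_le_tsum_norm (summable_norm_hpCoeff_mul f y)).trans
    (Real.tsum_le_of_sum_le (fun _ => norm_nonneg _) (hy f))

theorem tendstoUniformlyOn_taylorSum (f : HpTorus p) (z : polydisc) :
    ∃ t ∈ nhds z, TendstoUniformlyOn taylorSum (taylorSum f) (nhds f) t := by
  obtain ⟨C, hC⟩ := exists_eventually_norm_taylorSum_le (p := p) z
  refine ⟨_, hC, Metric.tendstoUniformlyOn_iff.2 fun ε hε => ?_⟩
  have hlim : Filter.Tendsto (fun g => C * ‖f - g‖) (nhds f) (nhds 0) := by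
    simpa using (by fun_prop : Continuous fun g : HpTorus p => C * ‖f - g‖).tendsto f
  filter_upwards [hlim.eventually (gt_mem_nhds hε)] with g hg y hy
  rw [dist_eq_norm, ← Pi.sub_apply, ← map_sub]
  exact (hy _).trans_lt hg

theorem isHolomorphic_taylorSum (f : HpTorus p) : IsHolomorphic (taylorSum f) := by
  have hspan : ∀ g ∈ Submodule.span ℂ (Set.range (hpChar p)), IsHolomorphic (taylorSum g) := by
    intro g hg
    induction hg using Submodule.span_induction with
    | mem _ h =>
      obtain ⟨α, rfl⟩ := h
      exact taylorSum_hpChar (p := p) α ▸ isHolomorphic_discMonomial α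
    | zero => exact (map_zero (taylorSum (p := p))).symm ▸ IsHolomorphic.zero
    | add g h _ _ hg hh => exact (map_add taylorSum g h).symm ▸ hg.add hh
    | smul c g _ hg => exact (map_smul taylorSum c g).symm ▸ hg.smul c
  have hf : f ∈ closure (Submodule.span ℂ (Set.range (hpChar p)) : Set (HpTorus p)) :=
    (topologicalClosure_span_hpChar (p := p)).ge Submodule.mem_top
  have : (Filter.comap (Subtype.val : Submodule.span ℂ (Set.range (hpChar p)) → HpTorus p)
      (nhds f)).NeBot := mem_closure_iff_comap_neBot.1 hf
  refine isHolomorphic_of_tendstoUniformlyOn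
    (u := fun g : Submodule.span ℂ (Set.range (hpChar p)) => taylorSum (g : HpTorus p))
    (l := Filter.comap Subtype.val (nhds f)) (fun g => hspan g g.2) fun z => ?_
  obtain ⟨t, ht, h⟩ := tendstoUniformlyOn_taylorSum f z
  exact ⟨t, ht, fun V hV => Filter.tendsto_comap.eventually (h V hV)⟩

end TaylorSeries

open Filter Topology in
theorem tendsto_translateIntegral_torusPoisson {p : ℝ≥0∞} [Fact (1 ≤ p)] [Fact (p ≠ ∞)]
    {ι : Type*} {l : Filter ι} {x : ι → ℕ → Set.Ico (0 : ℝ) 1}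
    (hx : ∀ i, Tendsto (fun k => (x k i : ℝ)) l (𝓝 1)) (f : Lp ℂ p torusMeasure) :
    Tendsto (fun k => translateIntegral 1 (torusPoisson (x k)) f) l (𝓝 f) := by
  have hlip : ∀ k, LipschitzWith 1
      (translateIntegral 1 (torusPoisson (x k)) : Lp ℂ p torusMeasure →L[ℂ] _) := fun k =>
    (ContinuousLinearMap.lipschitz _).weaken
      ((norm_translateIntegral_le _ _).trans norm_one.le)
  have hclosed := (LipschitzWith.uniformEquicontinuous _ 1 hlip).equicontinuous
    |>.isClosed_setOfPred_tendsto (l := l) continuous_id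
  refine hclosed.closure_subset_iff.2 (fun g hg => ?_)
    ((topologicalClosure_span_torusCharLp (p := p)).ge (Submodule.mem_top (x := f)))
  induction hg using Submodule.span_induction with
  | mem _ h =>
    obtain ⟨α, rfl⟩ := h
    simpa [translateIntegral_torusCharLp, integral_torusChar_torusPoisson] using
      (tendsto_poissonMultiplier hx α).smul_const (torusCharLp p α)
  | zero => simpa using tendsto_const_nhds
  | add g h _ _ hg hh => simpa using hg.add hh
  | smul c g _ hg => simpa using hg.const_smul c

/-- The projection of `𝕋^∞` onto the first `n` coordinates. -/
def torusRestrict (n : ℕ) (w : ℕ → Circle) : Fin n → Circle := fun i => w i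

theorem measurePreserving_torusRestrict (n : ℕ) :
    MeasurePreserving (torusRestrict n) torusMeasure (torusMeasureFin n) := by
  have hm : Measurable (torusRestrict n) := by unfold torusRestrict; fun_prop
  refine ⟨hm, (Measure.pi_eq fun s hs => ?_).symm⟩
  have h : torusRestrict n ⁻¹' Set.univ.pi s = Set.pi (Finset.range n : Set ℕ)
      (fun i => if h : i < n then s ⟨i, h⟩ else Set.univ) := by
    ext w
    simp only [torusRestrict, Set.mem_preimage, Set.mem_pi, Set.mem_univ, forall_const,
      Finset.coe_range, Set.mem_Iio]
    exact ⟨fun h i hi => by simpa [hi] using h ⟨i, hi⟩, fun h i => by simpa using h i i.2⟩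
  rw [Measure.map_apply hm (MeasurableSet.univ_pi hs), h, torusMeasure, Measure.infinitePi_pi,
    ← Fin.prod_univ_eq_prod_range]
  · simp
  · exact fun i hi => by simpa [Finset.mem_range.1 hi] using hs _

/-- The point `(x_0 w_0, …, x_{n-1} w_{n-1}, 0, 0, …)` of `𝔻^∞ ∩ ℓ₂`. -/
def scaledPoint (n : ℕ) (x : ℕ → Set.Ico (0 : ℝ) 1) (w : ℕ → Circle) : polydisc :=
  ⟨finPoint fun i : Fin n => ((x i : ℝ) : ℂ) * w i, finPoint_mem fun i => by
    rw [norm_mul, Circle.norm_coe, mul_one, Complex.norm_real, Real.norm_of_nonneg (x i).2.1]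
    exact (x i).2.2⟩

theorem scaledPoint_apply (n : ℕ) (x : ℕ → Set.Ico (0 : ℝ) 1) (w : ℕ → Circle) (i : ℕ) :
    (scaledPoint n x w : ellTwo) i = if i < n then ((x i : ℝ) : ℂ) * w i else 0 := by
  refine (finPoint_apply _ i).trans ?_
  split_ifs <;> rfl

theorem continuous_scaledPoint (n : ℕ) (x : ℕ → Set.Ico (0 : ℝ) 1) :
    Continuous (scaledPoint n x) :=
  Continuous.subtype_mk (continuous_finPoint.comp (by fun_prop)) _

/-- The sequence of radii `(r, …, r, 0, 0, …)` with `n` nonzero entries. -/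
def radii (n : ℕ) (r : Set.Ioo (0 : ℝ) 1) (i : ℕ) : Set.Ico (0 : ℝ) 1 :=
  if i < n then ⟨r, Set.Ioo_subset_Ico_self r.2⟩ else 0

theorem coe_radii (n : ℕ) (r : Set.Ioo (0 : ℝ) 1) (i : ℕ) :
    (radii n r i : ℝ) = if i < n then (r : ℝ) else 0 := by
  rw [radii]
  split_ifs <;> rfl

theorem tendsto_radii {r : ℕ → Set.Ioo (0 : ℝ) 1}
    (hr : Filter.Tendsto (fun k => (r k : ℝ)) Filter.atTop (nhds 1)) (i : ℕ) :
    Filter.Tendsto (fun k => (radii k (r k) i : ℝ)) Filter.atTop (nhds 1) := by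
  refine hr.congr' ?_
  filter_upwards [Filter.eventually_gt_atTop i] with k hk
  rw [coe_radii, if_pos hk]

theorem scaledPoint_radii (n : ℕ) (r : Set.Ioo (0 : ℝ) 1) (w : ℕ → Circle) :
    scaledPoint n (radii n r) w = torusPoint r (torusRestrict n w) := by
  refine Subtype.ext (congrArg finPoint (funext fun i => ?_))
  rw [coe_radii, if_pos i.2]
  rfl

theorem discMonomial_scaledPoint (α : ℕ →₀ ℕ) (n : ℕ) (r : Set.Ioo (0 : ℝ) 1)
    (w : ℕ → Circle) : discMonomial α (scaledPoint n (radii n r) w) =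
      poissonMultiplier (radii n r) (natIndex α) * torusChar (natIndex α) w := by
  have hsupp : (natIndex α).support = α.support :=
    Finsupp.support_mapRange_of_injective _ α Nat.cast_injective
  rw [poissonMultiplier, torusChar_eq_prod, hsupp, ← Finset.prod_mul_distrib]
  refine Finset.prod_congr rfl fun i hi => ?_
  change (scaledPoint n (radii n r) w : ellTwo) i ^ α i = _
  rw [scaledPoint_apply, coe_radii]
  split_ifs <;> simp [natIndex, mul_pow, Finsupp.mem_support_iff.1 hi]

/-- The restriction of a holomorphic function on `𝔻^∞ ∩ ℓ₂` to a torus with radii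
`x_0, …, x_{n-1}, 0, 0, …`, as a function on `𝕋^∞`. -/
def torusSlice {g : polydisc → ℂ} (hg : IsHolomorphic g) (n : ℕ) (x : ℕ → Set.Ico (0 : ℝ) 1) :
    C(ℕ → Circle, ℂ) :=
  ⟨fun w => g (scaledPoint n x w), hg.continuous.comp (continuous_scaledPoint n x)⟩

theorem enorm_toLp_torusSlice {p : ℝ≥0∞} [Fact (1 ≤ p)] {g : polydisc → ℂ}
    (hg : IsHolomorphic g) (n : ℕ) (r : Set.Ioo (0 : ℝ) 1) :
    ‖ContinuousMap.toLp p torusMeasure ℂ (torusSlice hg n (radii n r))‖ₑ =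
      eLpNorm (fun w => g (torusPoint r w)) p (torusMeasureFin n) := by
  rw [Lp.enorm_def, eLpNorm_congr_ae (ContinuousMap.coeFn_toLp torusMeasure _),
    ← eLpNorm_comp_measurePreserving (hg.aestronglyMeasurable r)
      (measurePreserving_torusRestrict n)]
  exact congrArg (eLpNorm · p torusMeasure) (funext fun w => congrArg g (scaledPoint_radii n r w))

section Isometry

variable {p : ℝ≥0∞} [Fact (1 ≤ p)] [Fact (p ≠ ∞)]

theorem continuous_torusSlice_taylorSum (n : ℕ) (x : ℕ → Set.Ico (0 : ℝ) 1) :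
    Continuous fun f : HpTorus p => torusSlice (isHolomorphic_taylorSum f) n x := by
  refine continuous_iff_continuousAt.2 fun f =>
    ContinuousMap.tendsto_iff_tendstoLocallyUniformly.2 fun V hV w => ?_
  obtain ⟨t, ht, h⟩ := tendstoUniformlyOn_taylorSum f (scaledPoint n x w)
  exact ⟨_, (continuous_scaledPoint n x).continuousAt.preimage_mem_nhds ht,
    (h V hV).mono fun g hg w hw => hg _ hw⟩

theorem toLp_torusSlice_taylorSum (f : HpTorus p) (n : ℕ) (r : Set.Ioo (0 : ℝ) 1) :
    ContinuousMap.toLp p torusMeasure ℂ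
        (torusSlice (isHolomorphic_taylorSum f) n (radii n r)) =
      translateIntegral 1 (torusPoisson (radii n r)) (f : Lp ℂ p torusMeasure) := by
  let A : HpTorus p →ₗ[ℂ] C(ℕ → Circle, ℂ) :=
    { toFun := fun f => torusSlice (isHolomorphic_taylorSum f) n (radii n r)
      map_add' := fun f g => ContinuousMap.ext fun w => congrFun (map_add taylorSum f g) _
      map_smul' := fun c f => ContinuousMap.ext fun w => congrFun (map_smul taylorSum c f) _ }
  suffices h : (ContinuousMap.toLp p torusMeasure ℂ).comp ⟨A, continuous_torusSlice_taylorSum n _⟩ =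
      (translateIntegral 1 (torusPoisson (radii n r))).comp (HpTorus p).subtypeL from
    congrArg (· f) h
  refine ContinuousLinearMap.ext_on
    (Submodule.dense_iff_topologicalClosure_eq_top.2 topologicalClosure_span_hpChar) ?_
  rintro _ ⟨α, rfl⟩
  have hA : A (hpChar p α) =
      poissonMultiplier (radii n r) (natIndex α) • torusChar (natIndex α) :=
    ContinuousMap.ext fun w =>
      (congrFun (taylorSum_hpChar α) _).trans (discMonomial_scaledPoint α n r w)
  have hT : translateIntegral 1 (torusPoisson (radii n r)) (torusCharLp p (natIndex α)) =
      poissonMultiplier (radii n r) (natIndex α) • torusCharLp p (natIndex α) := by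
    simp only [translateIntegral_torusCharLp, ContinuousMap.one_apply, one_mul,
      integral_torusChar_torusPoisson]
  exact ((congrArg _ hA).trans (map_smul _ _ _)).trans hT.symm

open Filter Topology in
theorem hpNorm_taylorSum (f : HpTorus p) : hpNorm p (taylorSum f) = ‖f‖ₑ := by
  refine le_antisymm (iSup₂_le fun n r => ?_) ?_
  · rw [← enorm_toLp_torusSlice (isHolomorphic_taylorSum f), toLp_torusSlice_taylorSum,
      enorm_le_iff_norm_le]
    refine (ContinuousLinearMap.le_of_opNorm_le _
      ((norm_translateIntegral_le _ _).trans norm_one.le) _).trans (one_mul _).le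
  · obtain ⟨r, -, hr, hlim⟩ := exists_seq_strictMono_tendsto' (zero_lt_one (α := ℝ))
    have h := tendsto_translateIntegral_torusPoisson
      (tendsto_radii (r := fun k => ⟨r k, hr k⟩) hlim) (f : Lp ℂ p torusMeasure)
    refine le_of_tendsto h.enorm (Eventually.of_forall fun k => ?_)
    rw [← toLp_torusSlice_taylorSum, enorm_toLp_torusSlice]
    exact eLpNorm_le_hpNorm p _ k _

/-- The map `φ` as an isometry of `H_p(𝕋^∞)` into `H_p(𝔻^∞)`. -/
def taylorIsometry (p : ℝ≥0∞) [Fact (1 ≤ p)] [Fact (p ≠ ∞)] : HpTorus p →ₗᵢ[ℂ] HpDisc p where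
  toFun f := ⟨taylorSum f, isHolomorphic_taylorSum f, hpNorm_taylorSum f ▸ enorm_lt_top⟩
  map_add' f g := Subtype.ext (map_add taylorSum f g)
  map_smul' c f := Subtype.ext (map_smul taylorSum c f)
  norm_map' f := (congrArg ENNReal.toReal (hpNorm_taylorSum f)).trans (toReal_enorm _)

theorem taylorIsometry_hpChar (α : ℕ →₀ ℕ) : taylorIsometry p (hpChar p α) = hpMonomial p α :=
  Subtype.ext (taylorSum_hpChar α)

theorem isClosed_hpTorus (p : ℝ≥0∞) [Fact (1 ≤ p)] :
    IsClosed (HpTorus p : Set (Lp ℂ p torusMeasure)) := by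
  have h : (HpTorus p : Set (Lp ℂ p torusMeasure)) =
      ⋂ (α : ℕ →₀ ℤ) (_ : ∃ i, α i < 0), {f | fourierCLM p α f = 0} := by
    ext f
    simp only [Set.mem_iInter, Set.mem_ofPred_eq]
    exact Iff.rfl
  exact h ▸ isClosed_iInter fun α => isClosed_iInter fun _ =>
    isClosed_eq (fourierCLM p α).continuous continuous_const

instance instCompleteSpaceHpTorus (p : ℝ≥0∞) [Fact (1 ≤ p)] : CompleteSpace (HpTorus p) :=
  (isClosed_hpTorus p).completeSpace_coe

theorem range_taylorIsometry : Set.range (taylorIsometry p) =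
    closure (Submodule.span ℂ (Set.range (hpMonomial p)) : Set (HpDisc p)) := by
  have hspan : (Submodule.span ℂ (Set.range (hpChar p))).map (taylorIsometry p).toLinearMap =
      Submodule.span ℂ (Set.range (hpMonomial p)) := by
    rw [Submodule.map_span, ← Set.range_comp]
    exact congrArg (Submodule.span ℂ <| Set.range ·) (funext taylorIsometry_hpChar)
  have hdense : closure (Submodule.span ℂ (Set.range (hpChar p)) : Set (HpTorus p)) = Set.univ :=
    congrArg SetLike.coe (topologicalClosure_span_hpChar (p := p))
  rw [← hspan, Submodule.map_coe]
  refine (taylorIsometry p).isometry.isClosedEmbedding.closure_image_eq _ ▸ ?_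
  rw [hdense, Set.image_univ]

end Isometry

/-! ### Uniform convexity -/

section UniformConvexity

open Filter Topology

theorem exists_forall_le_mul_of_isCompact {X : Type*} [TopologicalSpace X] {S : Set X}
    (hS : IsCompact S) {h φ : X → ℝ} (hh : Continuous h) (hφ : Continuous φ)
    (hφ0 : ∀ x ∈ S, 0 ≤ φ x) (hneg : ∀ x ∈ S, φ x = 0 → h x < 0) :
    ∃ C, 0 < C ∧ ∀ x ∈ S, h x ≤ C * φ x := by
  have hpos : ∀ x ∈ S ∩ {x | 0 ≤ h x}, 0 < φ x := fun x hx =>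
    (hφ0 x hx.1).lt_of_ne fun h0 => (hneg x hx.1 h0.symm).not_ge hx.2
  obtain ⟨C, hC⟩ := (hS.inter_right (isClosed_le continuous_const hh)).exists_bound_of_continuousOn
    (hh.continuousOn.div hφ.continuousOn fun x hx => (hpos x hx).ne')
  refine ⟨max C 1, by positivity, fun x hx => ?_⟩
  obtain hneg | hnn := lt_or_ge (h x) 0
  · exact hneg.le.trans (mul_nonneg (by positivity) (hφ0 x hx))
  · rw [← div_le_iff₀ (hpos x ⟨hx, hnn⟩)]
    exact (Real.le_norm_self _).trans ((hC x ⟨hx, hnn⟩).trans (le_max_left _ _))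

variable {E : Type*} [NormedAddCommGroup E] [NormedSpace ℝ E]

/-- The defect in the midpoint convexity inequality for `‖·‖ ^ q`. -/
def midpointDefect (q : ℝ) (a b : E) : ℝ :=
  (‖a‖ ^ q + ‖b‖ ^ q) / 2 - ‖(2⁻¹ : ℝ) • a + (2⁻¹ : ℝ) • b‖ ^ q

theorem norm_midpoint_le (a b : E) :
    ‖(2⁻¹ : ℝ) • a + (2⁻¹ : ℝ) • b‖ ≤ 2⁻¹ * ‖a‖ + 2⁻¹ * ‖b‖ :=
  norm_add_le_of_le (norm_smul_of_nonneg (by norm_num) a).le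
    (norm_smul_of_nonneg (by norm_num) b).le

theorem midpointDefect_nonneg {q : ℝ} (hq : 1 ≤ q) (a b : E) : 0 ≤ midpointDefect q a b := by
  have hconv := (convexOn_rpow hq).2 (norm_nonneg a) (norm_nonneg b)
    (by norm_num : (0 : ℝ) ≤ 2⁻¹) (by norm_num : (0 : ℝ) ≤ 2⁻¹) (by norm_num)
  have hmono := Real.rpow_le_rpow (norm_nonneg _) (norm_midpoint_le a b) (zero_le_one.trans hq)
  simp only [smul_eq_mul] at hconv
  unfold midpointDefect
  linarith

theorem eq_of_midpointDefect_eq_zero [StrictConvexSpace ℝ E] {q : ℝ} (hq : 1 < q) {a b : E}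
    (h : midpointDefect q a b = 0) : a = b := by
  have hq0 : 0 < q := zero_lt_one.trans hq
  have hhalf : (0 : ℝ) < 2⁻¹ := by norm_num
  unfold midpointDefect at h
  have hmono := Real.rpow_le_rpow (norm_nonneg _) (norm_midpoint_le a b) hq0.le
  have hnorm : ‖a‖ = ‖b‖ := by
    by_contra hne
    have hlt := (strictConvexOn_rpow hq).2 (norm_nonneg a) (norm_nonneg b) hne hhalf hhalf
      (by norm_num)
    simp only [smul_eq_mul] at hlt
    linarith
  by_contra hne
  have hlt := Real.rpow_lt_rpow (norm_nonneg _)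
    (norm_combo_lt_of_ne le_rfl hnorm.ge hne hhalf hhalf (by norm_num)) hq0
  rw [hnorm] at h hlt
  linarith

theorem midpointDefect_smul (q : ℝ) {c : ℝ} (hc : 0 ≤ c) (a b : E) :
    midpointDefect q (c • a) (c • b) = c ^ q * midpointDefect q a b := by
  unfold midpointDefect
  simp only [smul_comm _ c, ← smul_add, norm_smul_of_nonneg hc,
    Real.mul_rpow hc (norm_nonneg _)]
  ring

-- By homogeneity it is enough to compare on the unit sphere of `E × E`, which is compact and on
-- which the defect vanishes only at points of the diagonal, where the left side vanishes too.
theorem exists_norm_sub_rpow_le [ProperSpace E] [StrictConvexSpace ℝ E] {q : ℝ} (hq : 1 < q)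
    {ε : ℝ} (hε : 0 < ε) : ∃ C, 0 < C ∧ ∀ a b : E,
      ‖a - b‖ ^ q ≤ ε * (‖a‖ ^ q + ‖b‖ ^ q) + C * midpointDefect q a b := by
  have hq0 : 0 < q := zero_lt_one.trans hq
  have hdiag : ∀ x ∈ Metric.sphere (0 : E × E) 1, midpointDefect q x.1 x.2 = 0 →
      ‖x.1 - x.2‖ ^ q - ε * (‖x.1‖ ^ q + ‖x.2‖ ^ q) < 0 := by
    rintro ⟨a, b⟩ hx h0
    obtain rfl : a = b := eq_of_midpointDefect_eq_zero hq h0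
    have ha : ‖a‖ = 1 := by simpa using hx
    simp [ha, hq0.ne', hε]
  obtain ⟨C, hC0, hC⟩ := exists_forall_le_mul_of_isCompact (isCompact_sphere (0 : E × E) 1)
    (by fun_prop (disch := positivity)) (by unfold midpointDefect; fun_prop (disch := positivity))
    (fun x _ => midpointDefect_nonneg hq.le x.1 x.2) hdiag
  refine ⟨C, hC0, fun a b => ?_⟩
  obtain h0 | h0 := eq_or_ne (a, b) 0
  · obtain ⟨rfl, rfl⟩ := Prod.mk_eq_zero.1 h0
    simp [midpointDefect, hq0.ne']
  have hr := norm_pos_iff.2 h0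
  have hscaled := hC (‖(a, b)‖⁻¹ • (a, b)) (mem_sphere_zero_iff_norm.2 <| by
    rw [norm_smul_of_nonneg (inv_nonneg.2 hr.le), inv_mul_cancel₀ hr.ne'])
  simp only [Prod.smul_fst, Prod.smul_snd, ← smul_sub, midpointDefect_smul q (inv_nonneg.2 hr.le),
    norm_smul_of_nonneg (inv_nonneg.2 hr.le),
    Real.mul_rpow (inv_nonneg.2 hr.le) (norm_nonneg _)] at hscaled
  refine le_of_mul_le_mul_left ?_ (Real.rpow_pos_of_pos (inv_pos.2 hr) q)
  linarith

section Lp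

variable {X : Type*} [MeasurableSpace X] {μ : Measure X} {p : ℝ≥0∞}

theorem norm_rpow_eq_integral {F : Type*} [NormedAddCommGroup F] (hp0 : p ≠ 0) (hp : p ≠ ∞)
    (f : Lp F p μ) : ‖f‖ ^ p.toReal = ∫ w, ‖f w‖ ^ p.toReal ∂μ := by
  rw [Lp.norm_def, toReal_eLpNorm (Lp.aestronglyMeasurable f),
    lpNorm_eq_integral_norm_rpow_toReal hp0 hp (Lp.aestronglyMeasurable f),
    Real.rpow_inv_rpow (integral_nonneg fun w => by positivity) (ENNReal.toReal_pos hp0 hp).ne']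

theorem norm_midpoint_rpow_ae_eq (f g : Lp E p μ) :
    (fun w => ‖((2⁻¹ : ℝ) • f + (2⁻¹ : ℝ) • g) w‖ ^ p.toReal) =ᵐ[μ]
      fun w => ‖(2⁻¹ : ℝ) • f w + (2⁻¹ : ℝ) • g w‖ ^ p.toReal := by
  filter_upwards [Lp.coeFn_add ((2⁻¹ : ℝ) • f) ((2⁻¹ : ℝ) • g), Lp.coeFn_smul (2⁻¹ : ℝ) f,
    Lp.coeFn_smul (2⁻¹ : ℝ) g] with w hadd hf hg
  rw [hadd, Pi.add_apply, hf, hg, Pi.smul_apply, Pi.smul_apply]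

theorem hasIntegral_midpointDefect [Fact (1 ≤ p)] (hp : p ≠ ∞) (f g : Lp E p μ) :
    Integrable (fun w => midpointDefect p.toReal (f w) (g w)) μ ∧
      ∫ w, midpointDefect p.toReal (f w) (g w) ∂μ = midpointDefect p.toReal f g := by
  have hp0 : p ≠ 0 := (zero_lt_one.trans_le (Fact.out : 1 ≤ p)).ne'
  have hint : ∀ h : Lp E p μ, Integrable (fun w => ‖h w‖ ^ p.toReal) μ := fun h =>
    (Lp.memLp h).integrable_norm_rpow hp0 hp
  have hmean := ((hint f).add (hint g)).div_const 2
  have hmid := (hint _).congr (norm_midpoint_rpow_ae_eq f g)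
  refine ⟨hmean.sub hmid, (integral_sub hmean hmid).trans ?_⟩
  simp only [Pi.add_apply]
  rw [integral_div, integral_add (hint f) (hint g), midpointDefect, norm_rpow_eq_integral hp0 hp,
    norm_rpow_eq_integral hp0 hp, norm_rpow_eq_integral hp0 hp,
    integral_congr_ae (norm_midpoint_rpow_ae_eq f g)]

theorem exists_norm_sub_rpow_le_Lp [ProperSpace E] [StrictConvexSpace ℝ E] (μ : Measure X)
    [Fact (1 ≤ p)] (hp : p ≠ ∞) (hq : 1 < p.toReal) {ε : ℝ} (hε : 0 < ε) :
    ∃ C, 0 < C ∧ ∀ f g : Lp E p μ, ‖f - g‖ ^ p.toReal ≤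
      ε * (‖f‖ ^ p.toReal + ‖g‖ ^ p.toReal) + C * midpointDefect p.toReal f g := by
  have hp0 : p ≠ 0 := (zero_lt_one.trans_le (Fact.out : 1 ≤ p)).ne'
  obtain ⟨C, hC0, hC⟩ := exists_norm_sub_rpow_le (E := E) hq hε
  refine ⟨C, hC0, fun f g => ?_⟩
  have hint : ∀ h : Lp E p μ, Integrable (fun w => ‖h w‖ ^ p.toReal) μ := fun h =>
    (Lp.memLp h).integrable_norm_rpow hp0 hp
  obtain ⟨hdefect, hdefect_eq⟩ := hasIntegral_midpointDefect hp f g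
  have hsum : Integrable (fun w => ε * (‖f w‖ ^ p.toReal + ‖g w‖ ^ p.toReal)) μ :=
    ((hint f).add (hint g)).const_mul ε
  calc ‖f - g‖ ^ p.toReal
    _ = ∫ w, ‖(f - g) w‖ ^ p.toReal ∂μ := norm_rpow_eq_integral hp0 hp _
    _ ≤ ∫ w, ε * (‖f w‖ ^ p.toReal + ‖g w‖ ^ p.toReal) +
          C * midpointDefect p.toReal (f w) (g w) ∂μ := by
      refine integral_mono_ae (hint _) (hsum.add (hdefect.const_mul C)) ?_
      filter_upwards [Lp.coeFn_sub f g] with w hw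
      simpa only [hw, Pi.sub_apply] using hC (f w) (g w)
    _ = ε * (‖f‖ ^ p.toReal + ‖g‖ ^ p.toReal) + C * midpointDefect p.toReal f g := by
      rw [integral_add hsum (hdefect.const_mul C), integral_const_mul, integral_const_mul,
        integral_add (hint f) (hint g), hdefect_eq, norm_rpow_eq_integral hp0 hp,
        norm_rpow_eq_integral hp0 hp]

theorem uniformConvexSpace_Lp [ProperSpace E] [StrictConvexSpace ℝ E] (μ : Measure X)
    [Fact (1 ≤ p)] (hp1 : 1 < p) (hp : p ≠ ∞) : UniformConvexSpace (Lp E p μ) where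
  uniform_convex ε hε := by
    have hq : 1 < p.toReal := by
      rwa [← ENNReal.toReal_one, ENNReal.toReal_lt_toReal ENNReal.one_ne_top hp]
    have hq0 : 0 < p.toReal := zero_lt_one.trans hq
    obtain ⟨C, hC0, hC⟩ := exists_norm_sub_rpow_le_Lp (E := E) μ hp hq
      (ε := ε ^ p.toReal / 4) (by positivity)
    refine ⟨ε ^ p.toReal / (C * p.toReal), by positivity, fun f hf g hg hfg => ?_⟩
    have hmid : ‖(2⁻¹ : ℝ) • f + (2⁻¹ : ℝ) • g‖ = 2⁻¹ * ‖f + g‖ := by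
      rw [← smul_add, norm_smul_of_nonneg (by norm_num)]
    have hsep := (Real.rpow_le_rpow hε.le hfg hq0.le).trans (hC f g)
    rw [midpointDefect, hf, hg, hmid, Real.one_rpow] at hsep
    have hbernoulli := one_add_mul_self_le_rpow_one_add (s := 2⁻¹ * ‖f + g‖ - 1)
      (by linarith [norm_nonneg (f + g)]) hq.le
    rw [add_sub_cancel] at hbernoulli
    have hgap : ε ^ p.toReal / 2 ≤ C * (p.toReal * (1 - 2⁻¹ * ‖f + g‖)) :=
      (by linarith : ε ^ p.toReal / 2 ≤ C * (1 - (2⁻¹ * ‖f + g‖) ^ p.toReal)).trans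
        (mul_le_mul_of_nonneg_left (by linarith) hC0.le)
    rw [le_sub_comm, div_le_iff₀ (by positivity)]
    linarith

end Lp

theorem cauchySeq_of_tendsto_norm [UniformConvexSpace E] {x : ℕ → E} {d : ℝ}
    (hx : Tendsto (fun n => ‖x n‖) atTop (𝓝 d))
    (hadd : Tendsto (fun q : ℕ × ℕ => ‖x q.1 + x q.2‖) atTop (𝓝 (2 * d))) : CauchySeq x := by
  obtain hd | hd := (ge_of_tendsto' hx fun n => norm_nonneg _).eq_or_lt
  · exact (tendsto_zero_iff_norm_tendsto_zero.2 (hd ▸ hx)).cauchySeq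
  refine Metric.cauchySeq_iff.2 fun ε hε => ?_
  obtain ⟨δ, hδ, h⟩ := exists_forall_closed_ball_dist_add_le_two_sub E
    (ε := ε / (2 * d)) (by positivity)
  have hr : ∀ᶠ r in 𝓝[>] d, (2 - δ) * r < 2 * d ∧ r < 2 * d := by
    refine nhdsWithin_le_nhds (Filter.Eventually.and ?_ (gt_mem_nhds (by linarith)))
    exact (by fun_prop : Continuous fun r => (2 - δ) * r).continuousAt.eventually
      (gt_mem_nhds (by linarith [mul_pos hδ hd]))
  obtain ⟨r, ⟨hrδ, hr2⟩, hdr⟩ := (hr.and self_mem_nhdsWithin).exists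
  have hr0 : 0 < r := hd.trans hdr
  obtain ⟨N, hN⟩ := eventually_atTop.1 (hx.eventually (gt_mem_nhds hdr))
  obtain ⟨M, hM⟩ := eventually_atTop.1 (hadd.eventually (lt_mem_nhds hrδ))
  refine ⟨max N (max M.1 M.2), fun j hj k hk => ?_⟩
  have hscale : ∀ y : E, ‖r⁻¹ • y‖ = ‖y‖ / r := fun y => by
    rw [norm_smul_of_nonneg (inv_nonneg.2 hr0.le), div_eq_inv_mul]
  have hball : ∀ i ≥ max N (max M.1 M.2), ‖r⁻¹ • x i‖ ≤ 1 := fun i hi => by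
    rw [hscale, div_le_one hr0]
    exact (hN i (le_of_max_le_left hi)).le
  by_contra! hjk
  rw [dist_eq_norm] at hjk
  have hle := h (hball j hj) (hball k hk) (by
    rw [← smul_sub, hscale]
    gcongr)
  rw [← smul_add, hscale, div_le_iff₀ hr0] at hle
  exact (hM (j, k) ⟨le_of_max_le_left (le_of_max_le_right hj),
    le_of_max_le_right (le_of_max_le_right hk)⟩).not_ge hle

theorem infDist_zero_le_norm {F : Type*} [NormedAddCommGroup F] {K : Set F} {x : F}
    (hx : x ∈ K) : Metric.infDist 0 K ≤ ‖x‖ := by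
  simpa only [dist_zero_left] using Metric.infDist_le_dist_of_mem (x := 0) hx

theorem tendsto_norm_add_of_tendsto_infDist {K : ℕ → Set E} (hanti : Antitone K)
    (hconv : ∀ n, Convex ℝ (K n)) {x : ℕ → E} (hxK : ∀ n, x n ∈ K n) {d : ℝ}
    (hdist : Tendsto (fun n => Metric.infDist 0 (K n)) atTop (𝓝 d))
    (hnorm : Tendsto (fun n => ‖x n‖) atTop (𝓝 d)) :
    Tendsto (fun q : ℕ × ℕ => ‖x q.1 + x q.2‖) atTop (𝓝 (2 * d)) := by
  rw [two_mul, ← prod_atTop_atTop_eq]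
  have hmin : Tendsto (fun q : ℕ × ℕ => min q.1 q.2) (atTop ×ˢ atTop) atTop :=
    tendsto_atTop.2 fun N => ((tendsto_fst.eventually_ge_atTop N).and
      (tendsto_snd.eventually_ge_atTop N)).mono fun q h => le_min h.1 h.2
  refine tendsto_of_tendsto_of_tendsto_of_le_of_le
    ((hdist.comp hmin).add (hdist.comp hmin))
    ((hnorm.comp tendsto_fst).add (hnorm.comp tendsto_snd)) (fun q => ?_) fun q => norm_add_le _ _
  have h := infDist_zero_le_norm <| hconv (min q.1 q.2) (hanti (min_le_left _ _) (hxK q.1))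
    (hanti (min_le_right _ _) (hxK q.2)) (by norm_num : (0 : ℝ) ≤ 2⁻¹)
    (by norm_num : (0 : ℝ) ≤ 2⁻¹) (by norm_num)
  rw [← smul_add, norm_smul_of_nonneg (by norm_num)] at h
  simp only [Function.comp_apply]
  linarith

-- Near-minimal elements of the sets `K n` form a Cauchy sequence.
theorem nonempty_iInter_of_antitone_convex [CompleteSpace E] [UniformConvexSpace E]
    {K : ℕ → Set E} (hanti : Antitone K) (hconv : ∀ n, Convex ℝ (K n))
    (hclosed : ∀ n, IsClosed (K n)) (hne : ∀ n, (K n).Nonempty)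
    (hbdd : Bornology.IsBounded (K 0)) : (⋂ n, K n).Nonempty := by
  obtain ⟨R, hR⟩ := hbdd.exists_norm_le
  have hmono : Monotone fun n => Metric.infDist 0 (K n) := fun m n hmn =>
    Metric.infDist_le_infDist_of_subset (hanti hmn) (hne n)
  have hle : ∀ n, Metric.infDist 0 (K n) ≤ R := fun n =>
    have ⟨x, hx⟩ := hne n
    (infDist_zero_le_norm hx).trans (hR x (hanti n.zero_le hx))
  have hdist := tendsto_atTop_ciSup hmono ⟨R, Set.forall_mem_range.2 hle⟩
  choose x hxK hx using fun n =>
    (Metric.infDist_lt_iff (hne n)).1 (lt_add_of_pos_right (Metric.infDist 0 (K n))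
      (Nat.one_div_pos_of_nat (α := ℝ) (n := n)))
  have hnorm : Tendsto (fun n => ‖x n‖) atTop (𝓝 (⨆ n, Metric.infDist 0 (K n))) := by
    refine tendsto_of_tendsto_of_tendsto_of_le_of_le hdist ?_
      (fun n => infDist_zero_le_norm (hxK n)) fun n => (dist_zero_left (x n)).ge.trans (hx n).le
    simpa using hdist.add tendsto_one_div_add_atTop_nhds_zero_nat
  obtain ⟨y, hy⟩ := cauchySeq_tendsto_of_complete <|
    cauchySeq_of_tendsto_norm hnorm <|
      tendsto_norm_add_of_tendsto_infDist hanti hconv hxK hdist hnorm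
  refine ⟨y, Set.mem_iInter.2 fun n => (hclosed n).mem_of_tendsto hy ?_⟩
  filter_upwards [eventually_ge_atTop n] with m hm
  exact hanti hm (hxK m)

theorem exists_forall_clm_eq_of_tendsto [CompleteSpace E] [UniformConvexSpace E] {u : ℕ → E}
    {R : ℝ} (hu : ∀ n, ‖u n‖ ≤ R) : ∃ x : E, ∀ {F : Type*} [NormedAddCommGroup F]
      [NormedSpace ℝ F] (ψ : E →L[ℝ] F) (c : F), Tendsto (fun n => ψ (u n)) atTop (𝓝 c) →
        ψ x = c := by
  let K : ℕ → Set E := fun n => closedConvexHull ℝ (u '' Set.Ici n)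
  have hK : K 0 ⊆ Metric.closedBall 0 R := closedConvexHull_min
    (Set.image_subset_iff.2 fun n _ => mem_closedBall_zero_iff.2 (hu n))
    (convex_closedBall 0 R) Metric.isClosed_closedBall
  obtain ⟨x, hx⟩ := nonempty_iInter_of_antitone_convex (K := K)
    (fun m n hmn => (closedConvexHull ℝ).monotone (Set.image_mono (Set.Ici_subset_Ici.2 hmn)))
    (fun n => convex_closedConvexHull) (fun n => isClosed_closedConvexHull)
    (fun n => ⟨u n, subset_closedConvexHull ⟨n, Set.self_mem_Ici, rfl⟩⟩)
    (Metric.isBounded_closedBall.subset hK)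
  refine ⟨x, fun ψ c hψ => eq_of_forall_dist_le fun ε hε => ?_⟩
  obtain ⟨n, hn⟩ := eventually_atTop.1 (hψ.eventually (Metric.closedBall_mem_nhds c hε))
  exact closedConvexHull_min (t := ψ ⁻¹' Metric.closedBall c ε)
    (Set.image_subset_iff.2 hn) ((convex_closedBall c ε).linear_preimage ψ.toLinearMap)
    (Metric.isClosed_closedBall.preimage ψ.continuous) (Set.mem_iInter.1 hx n)

end UniformConvexity

/-! ### Surjectivity -/

theorem torusMonomial_mul_torusMonomial_neg_mul (α : ℕ →₀ ℤ) (v w : ℕ → Circle) :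
    torusMonomial α v * torusMonomial (-α) (v * w) = torusMonomial (-α) w := by
  rw [torusMonomial_mul, torusMonomial_neg, torusMonomial_neg, mul_inv_cancel_left]

theorem fourierCoeff_integral_translate {X : Type*} [TopologicalSpace X] [CompactSpace X]
    [SecondCountableTopology X] [MeasurableSpace X] [BorelSpace X] (ν : Measure X)
    [IsFiniteMeasure ν] (b : C(X, ℂ)) (s : C(X, ℕ → Circle)) (u : C(ℕ → Circle, ℂ))
    (α : ℕ →₀ ℤ) :
    fourierCoeff (fun w => ∫ v, b v * u (s v * w) ∂ν) α =
      (∫ v, b v * torusChar α (s v) ∂ν) * fourierCoeff u α := by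
  have hint : Integrable (Function.uncurry fun (w : ℕ → Circle) (v : X) =>
      b v * u (s v * w) * torusMonomial (-α) w) (torusMeasure.prod ν) := by
    have hα : Continuous fun q : (ℕ → Circle) × X => (torusMonomial (-α) q.1 : ℂ) :=
      (continuous_torusMonomial (-α)).comp continuous_fst
    exact integrable_of_continuous (Continuous.mul (by fun_prop) hα)
  have hinner : ∀ v, ∫ w, b v * u (s v * w) * torusMonomial (-α) w ∂torusMeasure =
      b v * torusChar α (s v) * fourierCoeff u α := fun v => by
    rw [fourierCoeff, ← integral_mul_left_eq_self (fun w => u w * (torusMonomial (-α) w : ℂ)) (s v),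
      ← integral_const_mul]
    refine integral_congr_ae (.of_forall fun w => ?_)
    simp only [← torusMonomial_mul_torusMonomial_neg_mul α (s v) w, Circle.coe_mul, torusChar_apply]
    ring
  calc fourierCoeff (fun w => ∫ v, b v * u (s v * w) ∂ν) α
      = ∫ w, ∫ v, b v * u (s v * w) * torusMonomial (-α) w ∂ν ∂torusMeasure := by
        simp only [fourierCoeff, integral_mul_const]
    _ = ∫ v, b v * torusChar α (s v) * fourierCoeff u α ∂ν := by
        rw [integral_integral_swap hint]
        simp only [hinner]
    _ = _ := integral_mul_const _ _

/-- The point `z` with its `i`-th coordinate multiplied by `t`. -/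
def dilate (i : ℕ) (z : ellTwo) (t : ℂ) : ellTwo := z + lp.single 2 i ((t - 1) * z i)

theorem dilate_apply (i : ℕ) (z : ellTwo) (t : ℂ) (j : ℕ) :
    dilate i z t j = (if j = i then t else 1) * z j := by
  rw [dilate, lp.coeFn_add, Pi.add_apply, lp.single_apply, Pi.single_apply]
  split_ifs with h
  · rw [h]; ring
  · simp

theorem differentiable_dilate (i : ℕ) (z : ellTwo) : Differentiable ℂ (dilate i z) := by
  have h : Differentiable ℂ fun t : ℂ =>
      lp.singleContinuousLinearMap ℂ (fun _ : ℕ => ℂ) 2 i ((t - 1) * z i) := by fun_prop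
  exact h.const_add z

theorem dilate_mem_polydisc (i : ℕ) (z : polydisc) {t : ℂ} (ht : ‖t‖ ≤ 1) :
    dilate i z t ∈ polydisc := fun j => by
  rw [dilate_apply, norm_mul]
  refine (mul_le_of_le_one_left (norm_nonneg _) ?_).trans_lt (z.2 j)
  split_ifs
  exacts [ht, norm_one.le]

theorem scaledPoint_mulSingle_mul (n i : ℕ) (x : ℕ → Set.Ico (0 : ℝ) 1) (w : ℕ → Circle)
    (v : Circle) :
    (scaledPoint n x (Pi.mulSingle i v * w) : ellTwo) = dilate i (scaledPoint n x w) v := by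
  refine lp.ext (funext fun j => ?_)
  rw [dilate_apply, scaledPoint_apply, scaledPoint_apply, Pi.mul_apply, Pi.mulSingle_apply]
  split_ifs <;> simp [mul_left_comm]

theorem scaledPoint_mulSingle_radius (n i : ℕ) (x : ℕ → Set.Ico (0 : ℝ) 1) (w : ℕ → Circle)
    (ρ : Set.Ico (0 : ℝ) 1) :
    (scaledPoint n (Function.update x i (ρ * x i)) w : ellTwo) =
      dilate i (scaledPoint n x w) (ρ : ℝ) := by
  refine lp.ext (funext fun j => ?_)
  rw [dilate_apply, scaledPoint_apply, scaledPoint_apply, Function.update_apply]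
  split_ifs with h1 h2 <;> simp_all [mul_assoc]

section Slice

variable {g : polydisc → ℂ} (hg : IsHolomorphic g) (n : ℕ) (x : ℕ → Set.Ico (0 : ℝ) 1)

theorem integral_pow_mul_torusSlice (i k : ℕ) (w : ℕ → Circle) (ρ : Set.Ico (0 : ℝ) 1) :
    ∫ v : Circle, (v : ℂ) ^ k * torusSlice hg n x (Pi.mulSingle i v * w) ∂poissonMeasure ρ =
      ((ρ : ℝ) : ℂ) ^ k * torusSlice hg n (Function.update x i (ρ * x i)) w := by
  obtain ⟨G, hG, hGg⟩ := hg
  have hd : DiffContOnCl ℂ (fun t : ℂ => t ^ k * G (dilate i (scaledPoint n x w) t))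
      (Metric.ball 0 1) := by
    refine DifferentiableOn.diffContOnCl ?_
    rw [closure_ball _ one_ne_zero]
    exact DifferentiableOn.mul (by fun_prop) (hG.comp (differentiable_dilate i _).differentiableOn
      fun t ht => dilate_mem_polydisc i _ (mem_closedBall_zero_iff.1 ht))
  have h := integral_poissonMeasure_eq hd ρ
  simp only [← scaledPoint_mulSingle_mul, ← scaledPoint_mulSingle_radius, hGg] at h
  exact h

theorem fourierCoeff_torusSlice_update (ρ : Set.Ico (0 : ℝ) 1) (i k : ℕ) (α : ℕ →₀ ℤ) :
    ((ρ : ℝ) : ℂ) ^ (k + α i).natAbs * fourierCoeff (torusSlice hg n x) α =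
      ((ρ : ℝ) : ℂ) ^ k *
        fourierCoeff (torusSlice hg n (Function.update x i (ρ * x i))) α := by
  have hs : Continuous fun v : Circle => (Pi.mulSingle i v : ℕ → Circle) :=
    continuous_mulSingle (A := fun _ => Circle) i
  have h := fourierCoeff_integral_translate (poissonMeasure ρ) ⟨fun v => (v : ℂ) ^ k, by fun_prop⟩
    ⟨_, hs⟩ (torusSlice hg n x) α
  have hchar : ∀ v : Circle, (v : ℂ) ^ k * torusChar α (Pi.mulSingle i v) =
      (v : ℂ) ^ (k + α i) := fun v => by
    rw [torusChar_mulSingle, zpow_add₀ v.coe_ne_zero, zpow_natCast]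
  simp only [ContinuousMap.coe_mk, integral_pow_mul_torusSlice, hchar,
    integral_zpow_poissonMeasure] at h
  rw [← h]
  simp only [fourierCoeff, mul_assoc, integral_const_mul]

theorem fourierCoeff_torusSlice_eq_zero {α : ℕ →₀ ℤ} {i : ℕ} (hi : α i < 0) :
    fourierCoeff (torusSlice hg n x) α = 0 := by
  have h := fourierCoeff_torusSlice_update hg n x 0 i (α i).natAbs α
  have hsum : (((α i).natAbs : ℤ) + α i).natAbs = 0 := by lia
  rw [hsum, pow_zero, one_mul] at h
  simpa [hi.ne] using h

theorem fourierCoeff_torusSlice_piecewise (y : ℕ → Set.Ico (0 : ℝ) 1) (S : Finset ℕ)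
    (α : ℕ →₀ ℤ) :
    fourierCoeff (torusSlice hg n (S.piecewise (x * y) y)) α =
      (∏ i ∈ S, ((x i : ℝ) : ℂ) ^ (α i).natAbs) * fourierCoeff (torusSlice hg n y) α := by
  induction S using Finset.induction_on with
  | empty => simp
  | insert i S hi ih =>
    have h := fourierCoeff_torusSlice_update hg n (S.piecewise (x * y) y) (x i) i 0 α
    rw [Finset.piecewise_insert, Finset.prod_insert hi, mul_assoc, ← ih]
    simpa [hi] using h.symm

theorem fourierCoeff_torusSlice_mul (y : ℕ → Set.Ico (0 : ℝ) 1) (α : ℕ →₀ ℤ) :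
    fourierCoeff (torusSlice hg n (x * y)) α =
      poissonMultiplier x α * fourierCoeff (torusSlice hg n y) α := by
  let S := Finset.range n ∪ α.support
  have hpoint : ∀ w, scaledPoint n (S.piecewise (x * y) y) w = scaledPoint n (x * y) w := fun w =>
    Subtype.ext <| congrArg finPoint <| funext fun i => by simp [S]
  have hslice : (torusSlice hg n (S.piecewise (x * y) y) : (ℕ → Circle) → ℂ) =
      torusSlice hg n (x * y) := funext fun w => congrArg g (hpoint w)
  have hprod : poissonMultiplier x α = ∏ i ∈ S, ((x i : ℝ) : ℂ) ^ (α i).natAbs :=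
    Finset.prod_subset Finset.subset_union_right fun i _ hi => by
      simp [Finsupp.notMem_support_iff.1 hi]
  rw [← hslice, fourierCoeff_torusSlice_piecewise, hprod]

theorem poissonMultiplier_mul_fourierCoeff_torusSlice {k : ℕ} (hnk : n ≤ k)
    (r s : Set.Ioo (0 : ℝ) 1) (α : ℕ →₀ ℤ) :
    poissonMultiplier (radii n r) α * fourierCoeff (torusSlice hg k (radii k s)) α =
      poissonMultiplier (radii k s) α * fourierCoeff (torusSlice hg n (radii n r)) α := by
  have hpoint : ∀ w, scaledPoint k (radii n r * radii k s) w =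
      scaledPoint n (radii k s * radii n r) w := fun w =>
    Subtype.ext <| lp.ext <| funext fun i => by
      rw [scaledPoint_apply, scaledPoint_apply, Pi.mul_apply, Pi.mul_apply, Set.Ico.coe_mul,
        Set.Ico.coe_mul, coe_radii, coe_radii]
      by_cases hi : i < n
      · simp [hi, hi.trans_le hnk, mul_comm]
      · simp [hi]
  have hslice : (torusSlice hg k (radii n r * radii k s) : (ℕ → Circle) → ℂ) =
      torusSlice hg n (radii k s * radii n r) := funext fun w => congrArg g (hpoint w)
  rw [← fourierCoeff_torusSlice_mul, ← fourierCoeff_torusSlice_mul, hslice]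

end Slice

theorem torusRestrict_surjective (n : ℕ) : Function.Surjective (torusRestrict n) := fun w =>
  ⟨fun i => if h : i < n then w ⟨i, h⟩ else 1, funext fun i => by simp [torusRestrict]⟩

theorem IsHolomorphic.ext_torusSlice {g h : polydisc → ℂ} (hg : IsHolomorphic g)
    (hh : IsHolomorphic h)
    (heq : ∀ n r, torusSlice hg n (radii n r) = torusSlice hh n (radii n r)) : g = h := by
  suffices h0 : hpNorm 1 (g + (-1 : ℂ) • h) = 0 by
    have hsub := eq_zero_of_hpNorm_eq_zero (hg.add (hh.smul _)) h0
    rwa [neg_one_smul, ← sub_eq_add_neg, sub_eq_zero] at hsub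
  simp only [hpNorm, ENNReal.iSup_eq_zero]
  intro n r
  have hzero : (fun w : Fin n → Circle => (g + (-1 : ℂ) • h) (torusPoint r w)) = 0 := by
    refine funext ((torusRestrict_surjective n).forall.2 fun w => ?_)
    have hw : g (scaledPoint n (radii n r) w) = h (scaledPoint n (radii n r) w) :=
      DFunLike.congr_fun (heq n r) w
    rw [scaledPoint_radii] at hw
    simp [hw]
  rw [hzero, eLpNorm_zero]

section Surjectivity

variable {p : ℝ≥0∞} [Fact (1 ≤ p)]

open Filter Topology in
theorem exists_poissonMultiplier_mul_fourierCLM_eq [hp : Fact (p ≠ ∞)] (hp1 : 1 < p)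
    {g : polydisc → ℂ} (hg : IsHolomorphic g) (hfin : hpNorm p g < ∞) :
    ∃ f : HpTorus p, ∀ n r α, poissonMultiplier (radii n r) α * fourierCLM p α f =
      fourierCoeff (torusSlice hg n (radii n r)) α := by
  obtain ⟨r, -, hr, hlim⟩ := exists_seq_strictMono_tendsto' (zero_lt_one (α := ℝ))
  let s : ℕ → Set.Ioo (0 : ℝ) 1 := fun k => ⟨r k, hr k⟩
  let u : ℕ → Lp ℂ p torusMeasure := fun k =>
    ContinuousMap.toLp p torusMeasure ℂ (torusSlice hg k (radii k (s k)))
  have hu : ∀ k, ‖u k‖ ≤ (hpNorm p g).toReal := fun k => by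
    rw [← toReal_enorm, enorm_toLp_torusSlice]
    exact ENNReal.toReal_mono hfin.ne (eLpNorm_le_hpNorm p g k (s k))
  have := uniformConvexSpace_Lp (E := ℂ) torusMeasure hp1 hp.out
  obtain ⟨f, hf⟩ := exists_forall_clm_eq_of_tendsto hu
  have hmem : f ∈ HpTorus p := fun α ⟨i, hi⟩ => by
    refine hf ((fourierCLM p α).restrictScalars ℝ) 0 (tendsto_const_nhds.congr fun k => ?_)
    exact ((fourierCLM_toLp _ α).trans (fourierCoeff_torusSlice_eq_zero hg k _ hi)).symm
  refine ⟨⟨f, hmem⟩, fun n t α => ?_⟩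
  have hT : Tendsto (fun k => poissonMultiplier (radii k (s k)) α *
      fourierCoeff (torusSlice hg n (radii n t)) α) atTop
        (𝓝 (fourierCoeff (torusSlice hg n (radii n t)) α)) := by
    simpa using (tendsto_poissonMultiplier (tendsto_radii hlim) α).mul_const
      (fourierCoeff (torusSlice hg n (radii n t)) α)
  refine hf ((poissonMultiplier (radii n t) α • fourierCLM p α).restrictScalars ℝ) _
    (hT.congr' ?_)
  filter_upwards [eventually_ge_atTop n] with k hk
  rw [← poissonMultiplier_mul_fourierCoeff_torusSlice hg n hk, ← fourierCLM_toLp (p := p)]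
  rfl

variable [Fact (p ≠ ∞)]

theorem surjective_taylorIsometry (hp1 : 1 < p) : Function.Surjective (taylorIsometry p) := by
  intro g
  obtain ⟨f, hf⟩ := exists_poissonMultiplier_mul_fourierCLM_eq hp1 g.2.1 g.2.2
  refine ⟨f, Subtype.ext ((isHolomorphic_taylorSum f).ext_torusSlice g.2.1 fun n r => ?_)⟩
  refine ContinuousMap.toLp_injective (p := p) (𝕜 := ℂ) torusMeasure (lp_ext_fourierCoeff ?_)
  intro α
  rw [← fourierCLM_apply, ← fourierCLM_apply, toLp_torusSlice_taylorSum,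
    fourierCLM_translateIntegral, fourierCLM_toLp, ← hf]
  simp only [ContinuousMap.one_apply, one_mul, integral_torusChar_torusPoisson]

end Surjectivity

end HardyInf

end

theorem theorem5p1_general (p : ℝ≥0∞) [Fact (1 ≤ p)] (hp : p ≠ ∞) :
    ∃ φ : HardyInf.HpTorus p →ₗᵢ[ℂ] HardyInf.HpDisc p,
      (∀ (f : HardyInf.HpTorus p) (z : HardyInf.polydisc),
        HasSum (fun α : ℕ →₀ ℕ =>
          HardyInf.fourierCoeff (f : Lp ℂ p HardyInf.torusMeasure) (HardyInf.natIndex α) *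
            HardyInf.discMonomial α z) (φ f z)) ∧
      (1 < p → Function.Surjective φ) ∧
      Set.range φ =
        closure (Submodule.span ℂ (Set.range (HardyInf.hpMonomial p)) :
          Set (HardyInf.HpDisc p)) := by
  have : Fact (p ≠ ∞) := ⟨hp⟩
  exact ⟨HardyInf.taylorIsometry p, HardyInf.hasSum_taylorSum, HardyInf.surjective_taylorIsometry,
    HardyInf.range_taylorIsometry⟩

/-- For `1 ≤ p < ∞` the map `f ↦ ∑ f̂(α) z^α` is a well defined linear isometry from `H_p(𝕋^∞)`
into `H_p(𝔻^∞)`; it is onto for `1 < p < ∞`, and for `p = 1` its range is the closed linear span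
of the monomials in `H_1(𝔻^∞)`. -/
theorem theorem5p1 (p : ℝ≥0∞) [Fact (1 ≤ p)] (hp : p ≠ ∞) :
    ∃ φ : HardyInf.HpTorus p →ₗᵢ[ℂ] HardyInf.HpDisc p,
      (∀ (f : HardyInf.HpTorus p) (z : HardyInf.polydisc),
        HasSum (fun α : ℕ →₀ ℕ =>
          HardyInf.fourierCoeff (f : Lp ℂ p HardyInf.torusMeasure) (HardyInf.natIndex α) *
            HardyInf.discMonomial α z) (φ f z)) ∧
      (1 < p → Function.Surjective φ) ∧
      (p = 1 → Set.range φ =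
        closure (Submodule.span ℂ (Set.range (HardyInf.hpMonomial p)) :
          Set (HardyInf.HpDisc p))) := by
  obtain ⟨φ, hsum, hsurj, hrange⟩ := theorem5p1_general p hp
  exact ⟨φ, hsum, hsurj, fun _ => hrange⟩
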